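/- **Conventions.** $2^{\mathbb N}$ is Cantor space, $[\![\sigma]\!]$ is the set of sequences extending the finite binary string $\sigma$, and a $\Pi^0_1$ class is the complement in $2^{\mathbb N}$ of $\bigcup_{\sigma\in S}[\![\sigma]\!]$ for some c.e. set $S$ of strings (the empty class is allowed). A finite Borel measure $\mu$ on $2^{\mathbb N}$ is *computable* if there is a computable map $(\sigma,i)\mapsto q(\sigma,i)$ into the dyadic rationals with $|\mu([\![\sigma]\!])-q(\sigma,i)|\le 2^{-i}$ for all $\sigma,i$. A class $\mathcal C$ is *tt-negligible* if $\mu(\mathcal C)=0$ for every computable measure $\mu$. A $\Pi^0_1$ class $\mathcal C$ is *tt-deep* if for every computable measure $\mu$ there is a computable, non-decreasing, unbounded function $h:\mathbb N\to\mathbb N$ such that $\sum_{\sigma\in T_n}\mu([\![\sigma]\!])<2^{-h(n)}$ for all sufficiently large $n$, where $T_n$ is the set of strings of length $n$ that have an extension in $\mathcal C$. A *Turing functional* $\Phi$ is a c.e. set of pairs of strings such that whenever $(\sigma,\tau),(\sigma',\tau')\in\Phi$ and $\sigma$ is a prefix of $\sigma'$, the strings $\tau,\tau'$ are comparable; $X\in\mathrm{dom}(\Phi)$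 if the strings $\tau$ with $(\sigma,\tau)\in\Phi$ for some prefix $\sigma$ of $X$ are of unbounded length, and then $\Phi(X)$ is the sequence extending all of them. For $\Pi^0_1$ classes, $\mathcal C\le_w\mathcal D$ (Muchnik reducibility) means that for every $X\in\mathcal D$ there is a Turing functional $\Phi$ with $X\in\mathrm{dom}(\Phi)$ and $\Phi(X)\in\mathcal C$; $\mathcal C\le_s\mathcal D$ (Medvedev reducibility) means that there is a single Turing functional $\Phi$ with $\mathcal D\subseteq\mathrm{dom}(\Phi)$ and $\Phi(\mathcal D)\subseteq\mathcal C$. The degrees of $\Pi^0_1$ classes under the induced equivalence relations $\equiv_s$, $\equiv_w$ form the lattices $\mathcal E_s$ and $\mathcal E_w$; in both of them the meet and the join of the degrees of $\mathcal C$ and $\mathcal D$ are the degrees of $\{0^\frown X: X\in\mathcal C\}\cup\{1^\frown Y:Y\in\mathcal D\}$ and of $\{X\oplus Y: X\in\mathcal C,\ Y\in\mathcal D\}$, respectively. A *filter* in a lattice is a nonempty subset that is closed upwards and closed under binary meets. **Theorem.** A $\Pi^0_1$ class is tt-deep if and only if it is tt-negligible. For $\Pi^0_1$ classes, tt-depth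 is invariant under $\equiv_s$ and under $\equiv_w$, and the degrees of the tt-deep $\Pi^0_1$ classes form a filter in $\mathcal E_s$ and a filter in $\mathcal E_w$. -/

import Mathlib

open Set Filter MeasureTheory
open scoped ENNReal

namespace MassProblems

/-! ### Cantor space, strings, cylinders -/

/-- Cantor space `2^ℕ`; finite binary strings are `List Bool`. -/
abbrev Cantor : Type := ℕ → Bool

/-- `X ↾ n`, the string of the first `n` bits of `X`. -/
def restr (X : Cantor) (n : ℕ) : List Bool := (List.range n).map X

/-- The cylinder `⟦σ⟧` of all sequences with prefix `σ`. -/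
def cylinder (σ : List Bool) : Set Cantor := {X | restr X σ.length = σ}

/-- Effectively open classes: unions of the cylinders over a c.e. set of strings. -/
def IsSigma01 (U : Set Cantor) : Prop :=
  ∃ S : Set (List Bool), REPred (fun σ => σ ∈ S) ∧ U = ⋃ σ ∈ S, cylinder σ

/-- Effectively closed classes. -/
def IsPi01 (C : Set Cantor) : Prop := IsSigma01 Cᶜ

/-- The type of all `Π⁰₁` classes in Cantor space. -/
structure Pi01Class where
  carrier : Set Cantor
  isPi01 : IsPi01 carrier

/-! ### Computable measures, tt-negligibility, tt-depth -/

/-- A (finite Borel) measure on Cantor space is computable if the dyadic rational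
`num σ i / 2 ^ exp σ i`, computed from `σ` and `i`, approximates `μ ⟦σ⟧` to within `2 ^ (-i)`.
Since `μ ⟦σ⟧ ≥ 0`, natural numerators are no restriction. -/
def IsComputableMeasure (μ : Measure Cantor) : Prop :=
  IsFiniteMeasure μ ∧ ∃ num exp : List Bool → ℕ → ℕ, Computable₂ num ∧ Computable₂ exp ∧
    ∀ σ i, |(μ (cylinder σ)).toReal - (num σ i : ℝ) / 2 ^ exp σ i| ≤ (2 : ℝ)⁻¹ ^ i

/-- `C` is tt-negligible if it is null for every computable measure. -/
def TTNegligible (C : Set Cantor) : Prop :=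
  ∀ μ : Measure Cantor, IsComputableMeasure μ → μ C = 0

/-- The canonical co-c.e. tree of `C`: the strings with an extension in `C`. -/
def canonicalTree (C : Set Cantor) : Set (List Bool) := {σ | (cylinder σ ∩ C).Nonempty}

/-- The `n`-th level of a tree. -/
def treeLevel (T : Set (List Bool)) (n : ℕ) : Set (List Bool) := {σ ∈ T | σ.length = n}

/-- `μ(S) = ∑_{σ ∈ S} μ(⟦σ⟧)` for a set `S` of strings. -/
noncomputable def stringMass (μ : Measure Cantor) (S : Set (List Bool)) : ℝ≥0∞ :=
  ∑' σ : S, μ (cylinder σ)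

/-- A computable order: a computable, non-decreasing, unbounded function. -/
def IsComputableOrder (h : ℕ → ℕ) : Prop :=
  Computable h ∧ Monotone h ∧ ∀ k, ∃ n, k ≤ h n

/-- `C` is tt-deep if for every computable measure `μ` there is a computable order `h` with
`μ(T_n) < 2 ^ (-h n)` for all sufficiently large `n`, where `T` is the canonical tree of `C`. -/
def TTDeep (C : Set Cantor) : Prop :=
  ∀ μ : Measure Cantor, IsComputableMeasure μ → ∃ h : ℕ → ℕ, IsComputableOrder h ∧
    ∀ᶠ n in atTop, stringMass μ (treeLevel (canonicalTree C) n) < (2 : ℝ≥0∞)⁻¹ ^ h n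

/-! ### Turing functionals -/

/-- A Turing functional: a consistent c.e. set of pairs of strings. -/
structure TuringFunctional where
  graph : Set (List Bool × List Bool)
  re : REPred (fun p => p ∈ graph)
  consistent : ∀ σ τ σ' τ', (σ, τ) ∈ graph → (σ', τ') ∈ graph → σ <+: σ' →
    τ <+: τ' ∨ τ' <+: τ

namespace TuringFunctional

/-- The strings that `Φ` outputs on input `X`; they form a chain of prefixes of `Φ^X`. -/
def outputs (Φ : TuringFunctional) (X : Cantor) : Set (List Bool) :=
  {τ | ∃ n, (restr X n, τ) ∈ Φ.graph}

/-- `dom Φ`: the `X` for which `Φ^X` is infinite. -/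
def dom (Φ : TuringFunctional) : Set Cantor :=
  {X | ∀ n, ∃ τ ∈ Φ.outputs X, n ≤ τ.length}

open Classical in
/-- `Φ(X)`, meaningful for `X ∈ dom Φ`: the sequence all of whose prefixes are prefixes of
outputs of `Φ` on `X`. -/
noncomputable def eval (Φ : TuringFunctional) (X : Cantor) : Cantor :=
  fun i => decide (∃ τ ∈ Φ.outputs X, τ[i]? = some true)

end TuringFunctional

/-- Muchnik reducibility `C ≤_w D`. -/
def MuchnikLE (C D : Pi01Class) : Prop :=
  ∀ X ∈ D.carrier, ∃ Φ : TuringFunctional, X ∈ Φ.dom ∧ Φ.eval X ∈ C.carrier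

/-- Medvedev reducibility `C ≤_s D`. -/
def MedvedevLE (C D : Pi01Class) : Prop :=
  ∃ Φ : TuringFunctional, D.carrier ⊆ Φ.dom ∧ Φ.eval '' D.carrier ⊆ C.carrier

/-- `b⌢X`. -/
def consSeq (b : Bool) (X : Cantor) : Cantor := fun n => Nat.casesOn n b X

/-- `X ⊕ Y`, with `(X ⊕ Y)(2n) = X(n)` and `(X ⊕ Y)(2n+1) = Y(n)`. -/
def oplus (X Y : Cantor) : Cantor := fun n => if n % 2 = 0 then X (n / 2) else Y (n / 2)

/-- `{0⌢X : X ∈ C} ∪ {1⌢Y : Y ∈ D}`. -/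
def infSet (C D : Set Cantor) : Set Cantor := consSeq false '' C ∪ consSeq true '' D

/-- `{X ⊕ Y : X ∈ C, Y ∈ D}`. -/
def supSet (C D : Set Cantor) : Set Cantor := {Z | ∃ X ∈ C, ∃ Y ∈ D, Z = oplus X Y}

/-! ### Closure properties of c.e. predicates -/

section RE

variable {α β : Type*} [Primcodable α] [Primcodable β]

theorem re_of_exists {f : α → ℕ → Bool} (hf : Computable₂ f) {p : α → Prop}
    (h : ∀ a, p a ↔ ∃ n, f a n = true) : REPred p := by
  have h1 : Partrec fun a => Nat.rfind fun n => (Part.some (f a n) : Part Bool) :=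
    Partrec.rfind hf.partrec₂
  refine h1.dom_re.of_eq fun a => ?_
  rw [h]
  refine Nat.rfind_dom.trans ?_
  constructor
  · rintro ⟨n, hn, -⟩
    exact ⟨n, by simpa using hn⟩
  · rintro ⟨n, hn⟩
    exact ⟨n, by simpa using hn, fun _ => trivial⟩

theorem exists_of_re {p : α → Prop} (hp : REPred p) :
    ∃ f : α → ℕ → Bool, Computable₂ f ∧ ∀ a, p a ↔ ∃ n, f a n = true := by
  obtain ⟨c, hc⟩ := Nat.Partrec.Code.exists_code.1 hp
  refine ⟨fun a n => (c.evaln n (Encodable.encode a)).isSome, ?_, fun a => ?_⟩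
  · have : Primrec₂ fun (a : α) (n : ℕ) => (c.evaln n (Encodable.encode a)).isSome :=
      Primrec.option_isSome.comp (Nat.Partrec.Code.primrec_evaln.comp
        ((Primrec.snd.pair (Primrec.const c)).pair (Primrec.encode.comp Primrec.fst)))
    exact this.to_comp
  · have h1 : p a ↔ ∃ x, x ∈ c.eval (Encodable.encode a) := by
      rw [hc]
      simp
    rw [h1]
    constructor
    · rintro ⟨x, hx⟩
      obtain ⟨k, hk⟩ := Nat.Partrec.Code.evaln_complete.1 hx
      exact ⟨k, Option.isSome_iff_exists.2 ⟨x, hk⟩⟩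
    · rintro ⟨n, hn⟩
      obtain ⟨x, hx⟩ := Option.isSome_iff_exists.1 hn
      exact ⟨x, Nat.Partrec.Code.evaln_sound hx⟩

theorem re_exists {p : α → β → Prop} (hp : REPred fun q : α × β => p q.1 q.2) :
    REPred fun a => ∃ b, p a b := by
  obtain ⟨f, hf, h⟩ := exists_of_re hp
  let g : α → ℕ → Bool := fun a n =>
    ((Encodable.decode (α := β) n.unpair.1).map fun b => f (a, b) n.unpair.2).getD false
  refine re_of_exists (f := g) ?_ fun a => ?_
  · refine Computable.option_getD (Computable.option_map ?_ ?_) (Computable.const false)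
    · exact Computable.decode.comp
        (Computable.fst.comp (Computable.unpair.comp Computable.snd))
    · exact hf.comp ((Computable.fst.comp Computable.fst).pair Computable.snd)
        (Computable.snd.comp (Computable.unpair.comp (Computable.snd.comp Computable.fst)))
  · constructor
    · rintro ⟨b, hb⟩
      obtain ⟨n, hn⟩ := (h (a, b)).1 hb
      exact ⟨Nat.pair (Encodable.encode b) n, by simpa [g] using hn⟩
    · rintro ⟨n, hn⟩
      cases hd : Encodable.decode (α := β) n.unpair.1 with
      | none => simp [g, hd] at hn
      | some b => exact ⟨b, (h (a, b)).2 ⟨n.unpair.2, by simpa [g, hd] using hn⟩⟩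

theorem re_comp {p : β → Prop} (hp : REPred p) {f : α → β} (hf : Computable f) :
    REPred fun a => p (f a) := Partrec.comp hp hf

theorem re_and {p q : α → Prop} (hp : REPred p) (hq : REPred q) :
    REPred fun a => p a ∧ q a := by
  have : Partrec fun a => (Part.assert (p a) fun _ => Part.some ()).bind
      fun _ => Part.assert (q a) fun _ => Part.some () :=
    Partrec.bind hp (Partrec.comp hq Computable.fst).to₂
  refine this.dom_re.of_eq fun a => ?_
  simp [Part.dom_iff_mem]

theorem re_or {p q : α → Prop} (hp : REPred p) (hq : REPred q) :
    REPred fun a => p a ∨ q a := by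
  obtain ⟨f, hf, h⟩ := exists_of_re hp
  obtain ⟨g, hg, h'⟩ := exists_of_re hq
  refine re_of_exists (f := fun a n => f a n || g a n) ?_ fun a => ?_
  · exact Primrec.or.to_comp.comp hf hg
  · simp [h, h', exists_or]

theorem re_eq {f g : α → List Bool} (hf : Computable f) (hg : Computable g) :
    REPred fun a => f a = g a := by
  have h : REPred fun p : List Bool × List Bool => p.1 = p.2 :=
    (PrimrecPred.computablePred (Primrec.eq (α := List Bool))).to_re
  exact re_comp h (hf.pair hg)

theorem re_prefix {f g : α → List Bool} (hf : Computable f) (hg : Computable g) :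
    REPred fun a => f a <+: g a := by
  have : REPred fun a => ∃ ρ, f a ++ ρ = g a :=
    re_exists (re_eq (Computable.list_append.comp (hf.comp Computable.fst) Computable.snd)
      (hg.comp Computable.fst))
  exact this

end RE

/-! ### Strings -/

@[simp] theorem length_restr (X : Cantor) (n : ℕ) : (restr X n).length = n := by simp [restr]

theorem getElem?_restr (X : Cantor) (n i : ℕ) (b : Bool) :
    (restr X n)[i]? = some b ↔ i < n ∧ X i = b := by
  simp [restr, List.getElem?_eq_some_iff]

theorem prefix_iff (σ τ : List Bool) :
    σ <+: τ ↔ ∀ (i : ℕ) (b : Bool), σ[i]? = some b → τ[i]? = some b := by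
  rw [List.prefix_iff_getElem?]
  constructor
  · intro h i b hb
    obtain ⟨hi, rfl⟩ := List.getElem?_eq_some_iff.1 hb
    exact h i hi
  · intro h i hi
    exact h i _ (List.getElem?_eq_getElem hi)

theorem mem_cylinder_iff (σ : List Bool) (X : Cantor) :
    X ∈ cylinder σ ↔ ∀ (i : ℕ) (b : Bool), σ[i]? = some b → X i = b := by
  constructor
  · intro h i b hb
    have h' : restr X σ.length = σ := h
    rw [← h'] at hb
    exact ((getElem?_restr _ _ _ _).1 hb).2
  · intro h
    refine List.ext_getElem? fun i => ?_
    by_cases hi : i < σ.length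
    · rw [(getElem?_restr X σ.length i (X i)).2 ⟨hi, rfl⟩, List.getElem?_eq_getElem hi,
        h i _ (List.getElem?_eq_getElem hi)]
    · rw [List.getElem?_eq_none (by simpa using hi), List.getElem?_eq_none (by simpa using hi)]

theorem restr_prefix (X : Cantor) {m n : ℕ} (h : m ≤ n) : restr X m <+: restr X n := by
  rw [prefix_iff]
  intro i b hb
  rw [getElem?_restr] at *
  exact ⟨by omega, hb.2⟩

theorem mem_cylinder_restr (X : Cantor) (n : ℕ) : X ∈ cylinder (restr X n) := by
  rw [mem_cylinder_iff]
  intro i b hb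
  exact ((getElem?_restr _ _ _ _).1 hb).2

theorem restr_eq_of_prefix {σ : List Bool} {X : Cantor} {n : ℕ} (h : σ <+: restr X n) :
    σ = restr X σ.length := by
  have : X ∈ cylinder σ := by
    rw [mem_cylinder_iff]
    intro i b hb
    exact ((getElem?_restr _ _ _ _).1 ((prefix_iff _ _).1 h i b hb)).2
  exact this.symm

theorem prefix_restr {σ : List Bool} {X : Cantor} (h : X ∈ cylinder σ) {n : ℕ}
    (hn : σ.length ≤ n) : σ <+: restr X n := by
  have h' : restr X σ.length = σ := h
  rw [← h']
  exact restr_prefix X hn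

/-- Two strings agree on the positions where both are defined. -/
def Agree (σ τ : List Bool) : Prop :=
  ∀ (i : ℕ) (b c : Bool), σ[i]? = some b → τ[i]? = some c → b = c

theorem comparable_iff_agree (σ τ : List Bool) : (σ <+: τ ∨ τ <+: σ) ↔ Agree σ τ := by
  constructor
  · rintro (h | h) i b c hb hc
    · have := (prefix_iff _ _).1 h i b hb
      simp_all
    · have := (prefix_iff _ _).1 h i c hc
      simp_all
  · intro h
    rcases le_total σ.length τ.length with hl | hl
    · left
      rw [prefix_iff]
      intro i b hb
      obtain ⟨hi, -⟩ := List.getElem?_eq_some_iff.1 hb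
      have h2 : τ[i]? = some (τ[i]'(by omega)) := List.getElem?_eq_getElem _
      rw [h2, h i b _ hb h2]
    · right
      rw [prefix_iff]
      intro i b hb
      obtain ⟨hi, -⟩ := List.getElem?_eq_some_iff.1 hb
      have h2 : σ[i]? = some (σ[i]'(by omega)) := List.getElem?_eq_getElem _
      rw [h2, h i _ b h2 hb]

theorem Agree.mono {σ σ' τ τ' : List Bool} (h : Agree σ' τ') (h1 : σ <+: σ') (h2 : τ <+: τ') :
    Agree σ τ := fun i b c hb hc =>
  h i b c ((prefix_iff _ _).1 h1 i b hb) ((prefix_iff _ _).1 h2 i c hc)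

theorem agree_of_prefix {σ τ ρ : List Bool} (h1 : σ <+: ρ) (h2 : τ <+: ρ) : Agree σ τ :=
  fun i b c hb hc => by
    have := (prefix_iff _ _).1 h1 i b hb
    have := (prefix_iff _ _).1 h2 i c hc
    simp_all

/-- The bits of a string at even positions. -/
def evens (σ : List Bool) : List Bool :=
  (List.range ((σ.length + 1) / 2)).map fun i => σ.getD (2 * i) false

/-- The bits of a string at odd positions. -/
def odds (σ : List Bool) : List Bool :=
  (List.range (σ.length / 2)).map fun i => σ.getD (2 * i + 1) false

theorem getElem?_evens (σ : List Bool) (i : ℕ) : (evens σ)[i]? = σ[2 * i]? := by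
  by_cases h : 2 * i < σ.length
  · have h' : i < (σ.length + 1) / 2 := by omega
    simp [evens, h, h']
  · have h' : ¬ i < (σ.length + 1) / 2 := by omega
    rw [List.getElem?_eq_none (by simpa [evens] using h'),
      List.getElem?_eq_none (by simpa using h)]

theorem getElem?_odds (σ : List Bool) (i : ℕ) : (odds σ)[i]? = σ[2 * i + 1]? := by
  by_cases h : 2 * i + 1 < σ.length
  · have h' : i < σ.length / 2 := by omega
    simp [odds, h, h']
  · have h' : ¬ i < σ.length / 2 := by omega
    rw [List.getElem?_eq_none (by simpa [odds] using h'),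
      List.getElem?_eq_none (by simpa using h)]

theorem evens_mono {σ τ : List Bool} (h : σ <+: τ) : evens σ <+: evens τ := by
  rw [prefix_iff] at *
  intro i b hb
  rw [getElem?_evens] at *
  exact h _ _ hb

theorem odds_mono {σ τ : List Bool} (h : σ <+: τ) : odds σ <+: odds τ := by
  rw [prefix_iff] at *
  intro i b hb
  rw [getElem?_odds] at *
  exact h _ _ hb

theorem evens_restr_oplus (X Y : Cantor) (n : ℕ) : X ∈ cylinder (evens (restr (oplus X Y) n)) := by
  rw [mem_cylinder_iff]
  intro i b hb
  rw [getElem?_evens, getElem?_restr] at hb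
  simpa [oplus] using hb.2

theorem odds_restr_oplus (X Y : Cantor) (n : ℕ) : Y ∈ cylinder (odds (restr (oplus X Y) n)) := by
  rw [mem_cylinder_iff]
  intro i b hb
  rw [getElem?_odds, getElem?_restr] at hb
  have h1 : (2 * i + 1) % 2 = 1 := by omega
  have h2 : (2 * i + 1) / 2 = i := by omega
  simpa [oplus, h1, h2] using hb.2

theorem oplus_mem_cylinder {X Y : Cantor} {τ : List Bool} (h1 : X ∈ cylinder (evens τ))
    (h2 : Y ∈ cylinder (odds τ)) : oplus X Y ∈ cylinder τ := by
  rw [mem_cylinder_iff] at *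
  intro i b hb
  rcases Nat.mod_two_eq_zero_or_one i with hi | hi
  · have : 2 * (i / 2) = i := by omega
    simp only [oplus, hi, if_true]
    exact h1 _ _ (by rw [getElem?_evens, this, hb])
  · have : 2 * (i / 2) + 1 = i := by omega
    simp only [oplus, hi]
    exact h2 _ _ (by rw [getElem?_odds, this, hb])

theorem agree_of_evens_odds {σ τ : List Bool} (h1 : Agree (evens σ) (evens τ))
    (h2 : Agree (odds σ) (odds τ)) : Agree σ τ := by
  intro i b c hb hc
  rcases Nat.mod_two_eq_zero_or_one i with hi | hi
  · have : 2 * (i / 2) = i := by omega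
    exact h1 (i / 2) b c (by rw [getElem?_evens, this, hb]) (by rw [getElem?_evens, this, hc])
  · have : 2 * (i / 2) + 1 = i := by omega
    exact h2 (i / 2) b c (by rw [getElem?_odds, this, hb]) (by rw [getElem?_odds, this, hc])

theorem computable_evens : Computable evens := by
  have : Primrec evens :=
    Primrec.list_map
      (Primrec.list_range.comp (Primrec.nat_div2.comp (Primrec.succ.comp Primrec.list_length)
        |>.of_eq fun σ => Nat.div2_val _))
      ((Primrec.list_getD false).comp Primrec.fst
        (Primrec.nat_mul.comp (Primrec.const 2) Primrec.snd))
  exact this.to_comp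

theorem computable_odds : Computable odds := by
  have : Primrec odds :=
    Primrec.list_map
      (Primrec.list_range.comp (Primrec.nat_div2.comp Primrec.list_length
        |>.of_eq fun σ => Nat.div2_val _))
      ((Primrec.list_getD false).comp Primrec.fst
        (Primrec.succ.comp (Primrec.nat_mul.comp (Primrec.const 2) Primrec.snd)))
  exact this.to_comp

theorem consSeq_mem_cylinder (b c : Bool) (σ : List Bool) (X : Cantor) :
    consSeq b X ∈ cylinder (c :: σ) ↔ b = c ∧ X ∈ cylinder σ := by
  simp only [mem_cylinder_iff]
  constructor
  · intro h
    exact ⟨h 0 c (by simp), fun i d hd => h (i + 1) d (by simpa using hd)⟩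
  · rintro ⟨rfl, h⟩ i d hd
    cases i with
    | zero => simpa [consSeq] using hd
    | succ i => exact h i d (by simpa using hd)

theorem consSeq_eta (Z : Cantor) : consSeq (Z 0) (fun n => Z (n + 1)) = Z := by
  funext n
  cases n <;> rfl

theorem restr_consSeq (b : Bool) (X : Cantor) (n : ℕ) :
    restr (consSeq b X) (n + 1) = b :: restr X n := by
  have h : consSeq b X ∈ cylinder (b :: restr X n) :=
    (consSeq_mem_cylinder _ _ _ _).2 ⟨rfl, mem_cylinder_restr X n⟩
  have h' : restr (consSeq b X) (b :: restr X n).length = b :: restr X n := h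
  simpa using h'

theorem oplus_eta (Z : Cantor) : oplus (fun n => Z (2 * n)) (fun n => Z (2 * n + 1)) = Z := by
  funext n
  rcases Nat.mod_two_eq_zero_or_one n with hi | hi
  · have : 2 * (n / 2) = n := by omega
    simp [oplus, hi, this]
  · have : 2 * (n / 2) + 1 = n := by omega
    simp [oplus, hi, this]

theorem oplus_inj {X Y X' Y' : Cantor} (h : oplus X Y = oplus X' Y') : X = X' ∧ Y = Y' := by
  constructor
  · funext n
    simpa [oplus] using congrFun h (2 * n)
  · funext n
    have h1 : (2 * n + 1) % 2 = 1 := by omega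
    have h2 : (2 * n + 1) / 2 = n := by omega
    simpa [oplus, h1, h2] using congrFun h (2 * n + 1)

theorem consSeq_inj {b c : Bool} {X Y : Cantor} (h : consSeq b X = consSeq c Y) :
    b = c ∧ X = Y :=
  ⟨congrFun h 0, funext fun n => congrFun h (n + 1)⟩

/-! ### The infimum and supremum of two `Π⁰₁` classes -/

theorem isPi01_infSet {C D : Set Cantor} (hC : IsPi01 C) (hD : IsPi01 D) :
    IsPi01 (infSet C D) := by
  obtain ⟨S, hS, hSC⟩ := hC
  obtain ⟨T, hT, hTD⟩ := hD
  have key : ∀ (b : Bool) (S : Set (List Bool)), REPred (fun σ => σ ∈ S) →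
      REPred fun σ : List Bool => ∃ ρ, ρ ∈ S ∧ b :: ρ = σ := fun b S hS =>
    re_exists (re_and (re_comp hS Computable.snd)
      (re_eq (Computable.list_cons.comp (Computable.const b) Computable.snd) Computable.fst))
  refine ⟨{σ | (∃ ρ, ρ ∈ S ∧ false :: ρ = σ) ∨ ∃ ρ, ρ ∈ T ∧ true :: ρ = σ},
    re_or (key _ _ hS) (key _ _ hT), ?_⟩
  have hC' : ∀ X, X ∈ C ↔ ¬ ∃ ρ ∈ S, X ∈ cylinder ρ := fun X => by
    have : X ∈ Cᶜ ↔ ∃ ρ ∈ S, X ∈ cylinder ρ := by rw [hSC]; simp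
    rw [← this]; simp
  have hD' : ∀ X, X ∈ D ↔ ¬ ∃ ρ ∈ T, X ∈ cylinder ρ := fun X => by
    have : X ∈ Dᶜ ↔ ∃ ρ ∈ T, X ∈ cylinder ρ := by rw [hTD]; simp
    rw [← this]; simp
  ext Z
  obtain ⟨b, X, rfl⟩ : ∃ b X, Z = consSeq b X := ⟨_, _, (consSeq_eta Z).symm⟩
  have h1 : consSeq b X ∈ infSet C D ↔ (b = false ∧ X ∈ C) ∨ (b = true ∧ X ∈ D) := by
    constructor
    · rintro (⟨Y, hY, h⟩ | ⟨Y, hY, h⟩)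
      · obtain ⟨rfl, rfl⟩ := consSeq_inj h; exact Or.inl ⟨rfl, hY⟩
      · obtain ⟨rfl, rfl⟩ := consSeq_inj h; exact Or.inr ⟨rfl, hY⟩
    · rintro (⟨rfl, h⟩ | ⟨rfl, h⟩)
      · exact Or.inl ⟨X, h, rfl⟩
      · exact Or.inr ⟨X, h, rfl⟩
  rw [mem_compl_iff, h1, hC', hD']
  simp only [mem_iUnion, mem_ofPred_eq, exists_prop]
  constructor
  · intro h
    cases b with
    | false =>
      obtain ⟨ρ, hρ, hX⟩ : ∃ ρ ∈ S, X ∈ cylinder ρ := by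
        by_contra hc
        exact h (Or.inl ⟨rfl, hc⟩)
      exact ⟨false :: ρ, Or.inl ⟨ρ, hρ, rfl⟩, (consSeq_mem_cylinder _ _ _ _).2 ⟨rfl, hX⟩⟩
    | true =>
      obtain ⟨ρ, hρ, hX⟩ : ∃ ρ ∈ T, X ∈ cylinder ρ := by
        by_contra hc
        exact h (Or.inr ⟨rfl, hc⟩)
      exact ⟨true :: ρ, Or.inr ⟨ρ, hρ, rfl⟩, (consSeq_mem_cylinder _ _ _ _).2 ⟨rfl, hX⟩⟩
  · rintro ⟨σ, ⟨ρ, hρ, rfl⟩ | ⟨ρ, hρ, rfl⟩, hX⟩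
    · obtain ⟨rfl, hX'⟩ := (consSeq_mem_cylinder _ _ _ _).1 hX
      rintro (⟨-, h⟩ | ⟨h, -⟩)
      · exact h ⟨ρ, hρ, hX'⟩
      · cases h
    · obtain ⟨rfl, hX'⟩ := (consSeq_mem_cylinder _ _ _ _).1 hX
      rintro (⟨h, -⟩ | ⟨-, h⟩)
      · cases h
      · exact h ⟨ρ, hρ, hX'⟩

theorem isPi01_supSet {C D : Set Cantor} (hC : IsPi01 C) (hD : IsPi01 D) :
    IsPi01 (supSet C D) := by
  obtain ⟨S, hS, hSC⟩ := hC
  obtain ⟨T, hT, hTD⟩ := hD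
  refine ⟨{σ | (∃ ρ, ρ ∈ S ∧ ρ <+: evens σ) ∨ ∃ ρ, ρ ∈ T ∧ ρ <+: odds σ},
    re_or
      (re_exists (re_and (re_comp hS Computable.snd)
        (re_prefix Computable.snd (computable_evens.comp Computable.fst))))
      (re_exists (re_and (re_comp hT Computable.snd)
        (re_prefix Computable.snd (computable_odds.comp Computable.fst)))), ?_⟩
  have hC' : ∀ X, X ∈ C ↔ ¬ ∃ ρ ∈ S, X ∈ cylinder ρ := fun X => by
    have : X ∈ Cᶜ ↔ ∃ ρ ∈ S, X ∈ cylinder ρ := by rw [hSC]; simp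
    rw [← this]; simp
  have hD' : ∀ X, X ∈ D ↔ ¬ ∃ ρ ∈ T, X ∈ cylinder ρ := fun X => by
    have : X ∈ Dᶜ ↔ ∃ ρ ∈ T, X ∈ cylinder ρ := by rw [hTD]; simp
    rw [← this]; simp
  have trans : ∀ {ρ ρ' : List Bool} {X : Cantor}, ρ <+: ρ' → X ∈ cylinder ρ' →
      X ∈ cylinder ρ := by
    intro ρ ρ' X h hX
    rw [mem_cylinder_iff] at *
    exact fun i b hb => hX i b ((prefix_iff _ _).1 h i b hb)
  ext Z
  obtain ⟨X, Y, rfl⟩ : ∃ X Y, Z = oplus X Y := ⟨_, _, (oplus_eta Z).symm⟩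
  have h1 : oplus X Y ∈ supSet C D ↔ X ∈ C ∧ Y ∈ D := by
    constructor
    · rintro ⟨X', hX, Y', hY, h⟩
      obtain ⟨rfl, rfl⟩ := oplus_inj h
      exact ⟨hX, hY⟩
    · rintro ⟨hX, hY⟩
      exact ⟨X, hX, Y, hY, rfl⟩
  rw [mem_compl_iff, h1, hC', hD']
  simp only [mem_iUnion, mem_ofPred_eq, exists_prop]
  constructor
  · intro h
    by_cases hX : ∃ ρ ∈ S, X ∈ cylinder ρ
    · obtain ⟨ρ, hρ, hX⟩ := hX
      refine ⟨restr (oplus X Y) (2 * ρ.length), Or.inl ⟨ρ, hρ, ?_⟩, mem_cylinder_restr _ _⟩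
      rw [prefix_iff]
      intro i b hb
      obtain ⟨hi, -⟩ := List.getElem?_eq_some_iff.1 hb
      rw [getElem?_evens, getElem?_restr]
      exact ⟨by omega, by simpa [oplus] using (mem_cylinder_iff _ _).1 hX i b hb⟩
    · by_cases hY : ∃ ρ ∈ T, Y ∈ cylinder ρ
      · obtain ⟨ρ, hρ, hY⟩ := hY
        refine ⟨restr (oplus X Y) (2 * ρ.length + 1), Or.inr ⟨ρ, hρ, ?_⟩, mem_cylinder_restr _ _⟩
        rw [prefix_iff]
        intro i b hb
        obtain ⟨hi, -⟩ := List.getElem?_eq_some_iff.1 hb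
        rw [getElem?_odds, getElem?_restr]
        have h1 : (2 * i + 1) % 2 = 1 := by omega
        have h2 : (2 * i + 1) / 2 = i := by omega
        exact ⟨by omega, by simpa [oplus, h1, h2] using (mem_cylinder_iff _ _).1 hY i b hb⟩
      · exact absurd ⟨hX, hY⟩ h
  · rintro ⟨σ, ⟨ρ, hρ, hp⟩ | ⟨ρ, hρ, hp⟩, hZ⟩ ⟨hX, hY⟩
    · refine hX ⟨ρ, hρ, trans hp ?_⟩
      have hZ' : restr (oplus X Y) σ.length = σ := hZ
      rw [← hZ']
      exact evens_restr_oplus X Y _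
    · refine hY ⟨ρ, hρ, trans hp ?_⟩
      have hZ' : restr (oplus X Y) σ.length = σ := hZ
      rw [← hZ']
      exact odds_restr_oplus X Y _

/-- `inf(C, D)` as a `Π⁰₁` class. -/
def Pi01Class.inf (C D : Pi01Class) : Pi01Class :=
  ⟨infSet C.carrier D.carrier, isPi01_infSet C.isPi01 D.isPi01⟩

/-- `sup(C, D)` as a `Π⁰₁` class. -/
def Pi01Class.sup (C D : Pi01Class) : Pi01Class :=
  ⟨supSet C.carrier D.carrier, isPi01_supSet C.isPi01 D.isPi01⟩

/-! ### Turing functionals needed for the lattice structure -/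

namespace TuringFunctional

theorem agree_outputs (Φ : TuringFunctional) {X : Cantor} {τ τ' : List Bool}
    (h : τ ∈ Φ.outputs X) (h' : τ' ∈ Φ.outputs X) : Agree τ τ' := by
  obtain ⟨m, hm⟩ := h
  obtain ⟨n, hn⟩ := h'
  rw [← comparable_iff_agree]
  rcases le_total m n with hmn | hmn
  · exact Φ.consistent _ _ _ _ hm hn (restr_prefix X hmn)
  · exact (Φ.consistent _ _ _ _ hn hm (restr_prefix X hmn)).symm

/-- `X ∈ dom Φ` and `Φ(X) = Y`. -/
def Maps (Φ : TuringFunctional) (X Y : Cantor) : Prop := X ∈ Φ.dom ∧ Φ.eval X = Y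

theorem eval_mem_cylinder (Φ : TuringFunctional) {X : Cantor} {τ : List Bool}
    (h : τ ∈ Φ.outputs X) : Φ.eval X ∈ cylinder τ := by
  rw [mem_cylinder_iff]
  intro i b hb
  cases b with
  | true =>
    simp only [eval, decide_eq_true_eq]
    exact ⟨τ, h, hb⟩
  | false =>
    simp only [eval, decide_eq_false_iff_not]
    rintro ⟨τ', h', hb'⟩
    exact absurd (Φ.agree_outputs h h' i _ _ hb hb') (by simp)

theorem maps_iff (Φ : TuringFunctional) (X Y : Cantor) :
    Φ.Maps X Y ↔ X ∈ Φ.dom ∧ ∀ τ ∈ Φ.outputs X, Y ∈ cylinder τ := by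
  constructor
  · rintro ⟨h, rfl⟩
    exact ⟨h, fun τ hτ => Φ.eval_mem_cylinder hτ⟩
  · rintro ⟨h, h'⟩
    refine ⟨h, funext fun i => ?_⟩
    obtain ⟨τ, hτ, hl⟩ := h (i + 1)
    have h2 : τ[i]? = some (τ[i]'(by omega)) := List.getElem?_eq_getElem _
    rw [(mem_cylinder_iff _ _).1 (Φ.eval_mem_cylinder hτ) i _ h2,
      (mem_cylinder_iff _ _).1 (h' τ hτ) i _ h2]

theorem maps_restr {Φ : TuringFunctional} {X Y : Cantor} (h : Φ.Maps X Y) (n : ℕ) :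
    ∃ τ m, (restr X m, τ) ∈ Φ.graph ∧ restr Y n <+: τ := by
  obtain ⟨h1, h2⟩ := (Φ.maps_iff X Y).1 h
  obtain ⟨τ, ⟨m, hm⟩, hl⟩ := h1 n
  refine ⟨τ, m, hm, ?_⟩
  have h3 : restr Y τ.length = τ := h2 τ ⟨m, hm⟩
  rw [← h3]
  exact restr_prefix Y hl

/-- The functional given by a computable monotone map on strings. -/
def ofMono (f : List Bool → List Bool) (hf : Computable f)
    (hm : ∀ σ σ', σ <+: σ' → f σ <+: f σ') : TuringFunctional where
  graph := {p | f p.1 = p.2}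
  re := re_eq (hf.comp Computable.fst) Computable.snd
  consistent := by
    intro σ τ σ' τ' h h' hp
    have h1 : f σ = τ := h
    have h2 : f σ' = τ' := h'
    subst h1 h2
    exact Or.inl (hm _ _ hp)

theorem ofMono_maps {f : List Bool → List Bool} (hf : Computable f)
    (hm : ∀ σ σ', σ <+: σ' → f σ <+: f σ') {X Y : Cantor}
    (h : ∀ n, Y ∈ cylinder (f (restr X n))) (h' : ∀ n, ∃ m, n ≤ (f (restr X m)).length) :
    (ofMono f hf hm).Maps X Y := by
  rw [maps_iff]
  constructor
  · intro n
    obtain ⟨m, hm⟩ := h' n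
    exact ⟨f (restr X m), ⟨m, show f (restr X m) = f (restr X m) from rfl⟩, hm⟩
  · rintro τ ⟨n, hn⟩
    have hn' : f (restr X n) = τ := hn
    rw [← hn']
    exact h n

theorem exists_id : ∃ Θ : TuringFunctional, ∀ X, Θ.Maps X X :=
  ⟨ofMono id Computable.id fun _ _ h => h, fun X =>
    ofMono_maps _ _ (fun n => mem_cylinder_restr X n) fun n => ⟨n, by simp⟩⟩

theorem exists_cons (b : Bool) : ∃ Θ : TuringFunctional, ∀ X, Θ.Maps X (consSeq b X) :=
  ⟨ofMono (List.cons b) (Computable.list_cons.comp (Computable.const b) Computable.id)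
      fun _ _ h => (List.cons_prefix_cons).2 ⟨rfl, h⟩, fun X =>
    ofMono_maps _ _ (fun n => (consSeq_mem_cylinder _ _ _ _).2 ⟨rfl, mem_cylinder_restr X n⟩)
      fun n => ⟨n, by simp⟩⟩

theorem exists_left : ∃ Θ : TuringFunctional, ∀ X Y, Θ.Maps (oplus X Y) X :=
  ⟨ofMono evens computable_evens fun _ _ h => evens_mono h, fun X Y =>
    ofMono_maps _ _ (fun n => evens_restr_oplus X Y n)
      fun n => ⟨2 * n, by simp [evens]; omega⟩⟩

theorem exists_right : ∃ Θ : TuringFunctional, ∀ X Y, Θ.Maps (oplus X Y) Y :=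
  ⟨ofMono odds computable_odds fun _ _ h => odds_mono h, fun X Y =>
    ofMono_maps _ _ (fun n => odds_restr_oplus X Y n)
      fun n => ⟨2 * n, by simp [odds]⟩⟩

theorem exists_comp (Ψ Φ : TuringFunctional) :
    ∃ Θ : TuringFunctional, ∀ X Y Z, Φ.Maps X Y → Ψ.Maps Y Z → Θ.Maps X Z := by
  refine ⟨⟨{p | ∃ q : List Bool × List Bool,
    (p.1, q.1) ∈ Φ.graph ∧ (q.2, p.2) ∈ Ψ.graph ∧ q.2 <+: q.1}, ?_, ?_⟩, ?_⟩
  · refine re_exists (re_and (re_comp Φ.re ?_) (re_and (re_comp Ψ.re ?_) (re_prefix ?_ ?_)))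
    · exact (Computable.fst.comp Computable.fst).pair (Computable.fst.comp Computable.snd)
    · exact (Computable.snd.comp Computable.snd).pair (Computable.snd.comp Computable.fst)
    · exact Computable.snd.comp Computable.snd
    · exact Computable.fst.comp Computable.snd
  · rintro σ τ σ' τ' ⟨⟨q, r⟩, h1, h2, h3⟩ ⟨⟨q', r'⟩, h1', h2', h3'⟩ hp
    have hq := (comparable_iff_agree _ _).1 (Φ.consistent _ _ _ _ h1 h1' hp)
    rcases (comparable_iff_agree _ _).2 (hq.mono h3 h3') with h | h
    · exact Ψ.consistent _ _ _ _ h2 h2' h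
    · exact (Ψ.consistent _ _ _ _ h2' h2 h).symm
  · intro X Y Z hXY hYZ
    obtain ⟨hY1, hY2⟩ := (Φ.maps_iff _ _).1 hXY
    obtain ⟨hZ1, hZ2⟩ := (Ψ.maps_iff _ _).1 hYZ
    rw [maps_iff]
    constructor
    · intro n
      obtain ⟨τ, ⟨m, hm⟩, hl⟩ := hZ1 n
      obtain ⟨ρ, k, hk, hpre⟩ := maps_restr hXY m
      exact ⟨τ, ⟨k, ⟨(ρ, restr Y m), hk, hm, hpre⟩⟩, hl⟩
    · rintro τ ⟨n, ⟨⟨q, r⟩, h1, h2, h3⟩⟩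
      have hq : restr Y q.length = q := hY2 q ⟨n, h1⟩
      have hr : r = restr Y r.length := by
        refine restr_eq_of_prefix (n := q.length) ?_
        rw [hq]
        exact h3
      refine hZ2 τ ⟨r.length, ?_⟩
      rw [← hr]
      exact h2

theorem exists_cases (Φ Ψ : TuringFunctional) :
    ∃ Θ : TuringFunctional, ∀ X Y, (Φ.Maps X Y → Θ.Maps (consSeq false X) Y) ∧
      (Ψ.Maps X Y → Θ.Maps (consSeq true X) Y) := by
  have key : ∀ (b : Bool) (Φ : TuringFunctional), REPred fun p : List Bool × List Bool =>
      ∃ ρ, (ρ, p.2) ∈ Φ.graph ∧ b :: ρ = p.1 := fun b Φ =>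
    re_exists (re_and
      (re_comp Φ.re (Computable.snd.pair (Computable.snd.comp Computable.fst)))
      (re_eq (Computable.list_cons.comp (Computable.const b) Computable.snd)
        (Computable.fst.comp Computable.fst)))
  refine ⟨⟨{p | (∃ ρ, (ρ, p.2) ∈ Φ.graph ∧ false :: ρ = p.1) ∨
    ∃ ρ, (ρ, p.2) ∈ Ψ.graph ∧ true :: ρ = p.1}, re_or (key _ _) (key _ _), ?_⟩, ?_⟩
  · rintro σ τ σ' τ' (⟨ρ, h, rfl⟩ | ⟨ρ, h, rfl⟩) (⟨ρ', h', rfl⟩ | ⟨ρ', h', rfl⟩) hp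
    · exact Φ.consistent _ _ _ _ h h' (List.cons_prefix_cons.1 hp).2
    · exact absurd (List.cons_prefix_cons.1 hp).1 (by simp)
    · exact absurd (List.cons_prefix_cons.1 hp).1 (by simp)
    · exact Ψ.consistent _ _ _ _ h h' (List.cons_prefix_cons.1 hp).2
  · have inv : ∀ {b c : Bool} {X : Cantor} {ρ : List Bool} {n : ℕ},
        c :: ρ = restr (consSeq b X) n → c = b ∧ ρ = restr X ρ.length := by
      intro b c X ρ n h
      have h1 : consSeq b X ∈ cylinder (c :: ρ) := by
        rw [h]
        exact mem_cylinder_restr _ _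
      obtain ⟨h2, h3⟩ := (consSeq_mem_cylinder _ _ _ _).1 h1
      exact ⟨h2.symm, h3.symm⟩
    intro X Y
    constructor
    · intro h
      obtain ⟨h1, h2⟩ := (maps_iff _ _ _).1 h
      rw [maps_iff]
      constructor
      · intro n
        obtain ⟨τ, ⟨m, hm⟩, hl⟩ := h1 n
        exact ⟨τ, ⟨m + 1, Or.inl ⟨_, hm, (restr_consSeq _ _ _).symm⟩⟩, hl⟩
      · rintro τ ⟨n, ⟨ρ, hρ, he⟩ | ⟨ρ, hρ, he⟩⟩
        · obtain ⟨-, he⟩ := inv he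
          rw [he] at hρ
          exact h2 τ ⟨_, hρ⟩
        · exact absurd (inv he).1 (by simp)
    · intro h
      obtain ⟨h1, h2⟩ := (maps_iff _ _ _).1 h
      rw [maps_iff]
      constructor
      · intro n
        obtain ⟨τ, ⟨m, hm⟩, hl⟩ := h1 n
        exact ⟨τ, ⟨m + 1, Or.inr ⟨_, hm, (restr_consSeq _ _ _).symm⟩⟩, hl⟩
      · rintro τ ⟨n, ⟨ρ, hρ, he⟩ | ⟨ρ, hρ, he⟩⟩
        · exact absurd (inv he).1 (by simp)
        · obtain ⟨-, he⟩ := inv he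
          rw [he] at hρ
          exact h2 τ ⟨_, hρ⟩

theorem exists_pair (Φ Ψ : TuringFunctional) :
    ∃ Θ : TuringFunctional, ∀ X Y Z, Φ.Maps X Y → Ψ.Maps X Z → Θ.Maps X (oplus Y Z) := by
  have key : ∀ (Φ : TuringFunctional) (f : List Bool → List Bool), Computable f →
      REPred fun p : List Bool × List Bool => ∃ q : List Bool × List Bool,
        q ∈ Φ.graph ∧ q.1 <+: p.1 ∧ f p.2 <+: q.2 := fun Φ f hf =>
    re_exists (re_and (re_comp Φ.re Computable.snd) (re_and
      (re_prefix (Computable.fst.comp Computable.snd) (Computable.fst.comp Computable.fst))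
      (re_prefix (hf.comp (Computable.snd.comp Computable.fst))
        (Computable.snd.comp Computable.snd))))
  have ag : ∀ (Φ : TuringFunctional) {q q' : List Bool × List Bool} {σ : List Bool},
      q ∈ Φ.graph → q' ∈ Φ.graph → q.1 <+: σ → q'.1 <+: σ → Agree q.2 q'.2 := by
    intro Φ q q' σ h h' hp hp'
    rw [← comparable_iff_agree]
    rcases (comparable_iff_agree _ _).2 (agree_of_prefix hp hp') with h1 | h1
    · exact Φ.consistent _ _ _ _ h h' h1
    · exact (Φ.consistent _ _ _ _ h' h h1).symm
  refine ⟨⟨{p | (∃ q, q ∈ Φ.graph ∧ q.1 <+: p.1 ∧ evens p.2 <+: q.2) ∧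
    ∃ q, q ∈ Ψ.graph ∧ q.1 <+: p.1 ∧ odds p.2 <+: q.2},
    re_and (key _ _ computable_evens) (key _ _ computable_odds), ?_⟩, ?_⟩
  · rintro σ τ σ' τ' ⟨⟨q, h1, h2, h3⟩, ⟨r, k1, k2, k3⟩⟩ ⟨⟨q', h1', h2', h3'⟩, ⟨r', k1', k2', k3'⟩⟩ hp
    rw [comparable_iff_agree]
    exact agree_of_evens_odds ((ag Φ h1 h1' (h2.trans hp) h2').mono h3 h3')
      ((ag Ψ k1 k1' (k2.trans hp) k2').mono k3 k3')
  · intro X Y Z hY hZ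
    have hY2 := ((maps_iff _ _ _).1 hY).2
    have hZ2 := ((maps_iff _ _ _).1 hZ).2
    have out : ∀ (Φ : TuringFunctional) (W : Cantor) (n : ℕ) (q : List Bool × List Bool)
        (ρ : List Bool), (∀ τ ∈ Φ.outputs X, W ∈ cylinder τ) → q ∈ Φ.graph →
        q.1 <+: restr X n → ρ <+: q.2 → W ∈ cylinder ρ := by
      intro Φ W n q ρ hW hq hp hρ
      have h1 : q.2 ∈ Φ.outputs X := by
        refine ⟨q.1.length, ?_⟩
        rw [← restr_eq_of_prefix hp]
        exact hq
      have h2 := hW _ h1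
      rw [mem_cylinder_iff] at *
      exact fun i b hb => h2 i b ((prefix_iff _ _).1 hρ i b hb)
    rw [maps_iff]
    constructor
    · intro n
      obtain ⟨ρ, m, hm, hρ⟩ := maps_restr hY n
      obtain ⟨ρ', m', hm', hρ'⟩ := maps_restr hZ n
      refine ⟨restr (oplus Y Z) n, ⟨max m m', ⟨(restr X m, ρ), hm, ?_, ?_⟩,
        ⟨(restr X m', ρ'), hm', ?_, ?_⟩⟩, by simp⟩
      · exact restr_prefix X (le_max_left _ _)
      · refine (prefix_restr (evens_restr_oplus Y Z n) ?_).trans hρ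
        simp [evens]
        omega
      · exact restr_prefix X (le_max_right _ _)
      · refine (prefix_restr (odds_restr_oplus Y Z n) ?_).trans hρ'
        simp [odds]
        omega
    · rintro τ ⟨n, ⟨q, h1, h2, h3⟩, ⟨r, k1, k2, k3⟩⟩
      exact oplus_mem_cylinder (out Φ Y n q _ hY2 h1 h2 h3) (out Ψ Z n r _ hZ2 k1 k2 k3)

end TuringFunctional

open TuringFunctional

theorem muchnikLE_iff (C D : Pi01Class) : MuchnikLE C D ↔
    ∀ X ∈ D.carrier, ∃ Φ : TuringFunctional, ∃ Y ∈ C.carrier, Φ.Maps X Y := by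
  constructor
  · intro h X hX
    obtain ⟨Φ, h1, h2⟩ := h X hX
    exact ⟨Φ, _, h2, h1, rfl⟩
  · intro h X hX
    obtain ⟨Φ, Y, hY, h1, rfl⟩ := h X hX
    exact ⟨Φ, h1, hY⟩

theorem medvedevLE_iff (C D : Pi01Class) : MedvedevLE C D ↔
    ∃ Φ : TuringFunctional, ∀ X ∈ D.carrier, ∃ Y ∈ C.carrier, Φ.Maps X Y := by
  constructor
  · rintro ⟨Φ, h1, h2⟩
    exact ⟨Φ, fun X hX => ⟨_, h2 ⟨X, hX, rfl⟩, h1 hX, rfl⟩⟩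
  · rintro ⟨Φ, h⟩
    refine ⟨Φ, fun X hX => ?_, ?_⟩
    · obtain ⟨Y, -, h1, -⟩ := h X hX
      exact h1
    · rintro _ ⟨X, hX, rfl⟩
      obtain ⟨Y, hY, -, rfl⟩ := h X hX
      exact hY

/-! ### Degree lattices -/

/-- The facts which make the degrees of a reducibility on `Π⁰₁` classes a lattice with the given
infimum and supremum. -/
structure IsLatticeReducibility (r : Pi01Class → Pi01Class → Prop) : Prop where
  refl : ∀ C, r C C
  trans : ∀ C D E, r C D → r D E → r C E
  inf_left : ∀ C D : Pi01Class, r (C.inf D) C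
  inf_right : ∀ C D : Pi01Class, r (C.inf D) D
  le_inf : ∀ C D E : Pi01Class, r E C → r E D → r E (C.inf D)
  sup_left : ∀ C D : Pi01Class, r C (C.sup D)
  sup_right : ∀ C D : Pi01Class, r D (C.sup D)
  sup_le : ∀ C D E : Pi01Class, r C E → r D E → r (C.sup D) E

theorem muchnik_isLatticeReducibility : IsLatticeReducibility MuchnikLE where
  refl C := (muchnikLE_iff _ _).2 fun X hX => exists_id.imp fun Θ h => ⟨X, hX, h X⟩
  trans C D E h1 h2 := by
    rw [muchnikLE_iff] at *
    intro X hX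
    obtain ⟨Φ, Y, hY, hΦ⟩ := h2 X hX
    obtain ⟨Ψ, Z, hZ, hΨ⟩ := h1 Y hY
    obtain ⟨Θ, hΘ⟩ := exists_comp Ψ Φ
    exact ⟨Θ, Z, hZ, hΘ X Y Z hΦ hΨ⟩
  inf_left C D := (muchnikLE_iff _ _).2 fun X hX =>
    (exists_cons false).imp fun Θ h => ⟨_, Or.inl ⟨X, hX, rfl⟩, h X⟩
  inf_right C D := (muchnikLE_iff _ _).2 fun X hX =>
    (exists_cons true).imp fun Θ h => ⟨_, Or.inr ⟨X, hX, rfl⟩, h X⟩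
  le_inf C D E h1 h2 := by
    rw [muchnikLE_iff] at *
    rintro _ (⟨X, hX, rfl⟩ | ⟨X, hX, rfl⟩)
    · obtain ⟨Φ, Y, hY, hΦ⟩ := h1 X hX
      obtain ⟨Θ, hΘ⟩ := exists_cases Φ Φ
      exact ⟨Θ, Y, hY, (hΘ X Y).1 hΦ⟩
    · obtain ⟨Φ, Y, hY, hΦ⟩ := h2 X hX
      obtain ⟨Θ, hΘ⟩ := exists_cases Φ Φ
      exact ⟨Θ, Y, hY, (hΘ X Y).2 hΦ⟩
  sup_left C D := (muchnikLE_iff _ _).2 fun Z hZ => by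
    obtain ⟨X, hX, Y, hY, rfl⟩ := hZ
    exact exists_left.imp fun Θ h => ⟨X, hX, h X Y⟩
  sup_right C D := (muchnikLE_iff _ _).2 fun Z hZ => by
    obtain ⟨X, hX, Y, hY, rfl⟩ := hZ
    exact exists_right.imp fun Θ h => ⟨Y, hY, h X Y⟩
  sup_le C D E h1 h2 := by
    rw [muchnikLE_iff] at *
    intro X hX
    obtain ⟨Φ, Y, hY, hΦ⟩ := h1 X hX
    obtain ⟨Ψ, Z, hZ, hΨ⟩ := h2 X hX
    obtain ⟨Θ, hΘ⟩ := exists_pair Φ Ψ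
    exact ⟨Θ, _, ⟨Y, hY, Z, hZ, rfl⟩, hΘ X Y Z hΦ hΨ⟩

theorem medvedev_isLatticeReducibility : IsLatticeReducibility MedvedevLE where
  refl C := (medvedevLE_iff _ _).2 <| exists_id.imp fun Θ h X hX => ⟨X, hX, h X⟩
  trans C D E h1 h2 := by
    rw [medvedevLE_iff] at *
    obtain ⟨Φ, hΦ⟩ := h2
    obtain ⟨Ψ, hΨ⟩ := h1
    obtain ⟨Θ, hΘ⟩ := exists_comp Ψ Φ
    refine ⟨Θ, fun X hX => ?_⟩
    obtain ⟨Y, hY, hΦ⟩ := hΦ X hX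
    obtain ⟨Z, hZ, hΨ⟩ := hΨ Y hY
    exact ⟨Z, hZ, hΘ X Y Z hΦ hΨ⟩
  inf_left C D := (medvedevLE_iff _ _).2 <|
    (exists_cons false).imp fun Θ h X hX => ⟨_, Or.inl ⟨X, hX, rfl⟩, h X⟩
  inf_right C D := (medvedevLE_iff _ _).2 <|
    (exists_cons true).imp fun Θ h X hX => ⟨_, Or.inr ⟨X, hX, rfl⟩, h X⟩
  le_inf C D E h1 h2 := by
    rw [medvedevLE_iff] at *
    obtain ⟨Φ, hΦ⟩ := h1
    obtain ⟨Ψ, hΨ⟩ := h2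
    obtain ⟨Θ, hΘ⟩ := exists_cases Φ Ψ
    refine ⟨Θ, ?_⟩
    rintro _ (⟨X, hX, rfl⟩ | ⟨X, hX, rfl⟩)
    · obtain ⟨Y, hY, hΦ⟩ := hΦ X hX
      exact ⟨Y, hY, (hΘ X Y).1 hΦ⟩
    · obtain ⟨Y, hY, hΨ⟩ := hΨ X hX
      exact ⟨Y, hY, (hΘ X Y).2 hΨ⟩
  sup_left C D := (medvedevLE_iff _ _).2 <| exists_left.imp fun Θ h Z hZ => by
    obtain ⟨X, hX, Y, hY, rfl⟩ := hZ
    exact ⟨X, hX, h X Y⟩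
  sup_right C D := (medvedevLE_iff _ _).2 <| exists_right.imp fun Θ h Z hZ => by
    obtain ⟨X, hX, Y, hY, rfl⟩ := hZ
    exact ⟨Y, hY, h X Y⟩
  sup_le C D E h1 h2 := by
    rw [medvedevLE_iff] at *
    obtain ⟨Φ, hΦ⟩ := h1
    obtain ⟨Ψ, hΨ⟩ := h2
    obtain ⟨Θ, hΘ⟩ := exists_pair Φ Ψ
    refine ⟨Θ, fun X hX => ?_⟩
    obtain ⟨Y, hY, hΦ⟩ := hΦ X hX
    obtain ⟨Z, hZ, hΨ⟩ := hΨ X hX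
    exact ⟨_, ⟨Y, hY, Z, hZ, rfl⟩, hΘ X Y Z hΦ hΨ⟩

/-- `C ≡ D` if and only if `C ≤ D` and `D ≤ C`. -/
def degreeSetoid {r : Pi01Class → Pi01Class → Prop} (h : IsLatticeReducibility r) :
    Setoid Pi01Class where
  r C D := r C D ∧ r D C
  iseqv :=
    ⟨fun C => ⟨h.refl C, h.refl C⟩, fun h => ⟨h.2, h.1⟩,
      fun h1 h2 => ⟨h.trans _ _ _ h1.1 h2.1, h.trans _ _ _ h2.2 h1.2⟩⟩

/-- The lattice of degrees, ordered by `[C] ≤ [D] ↔ C ≤ D`, with `[C] ⊓ [D] = [inf(C, D)]` and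
`[C] ⊔ [D] = [sup(C, D)]`. -/
@[reducible]
def degreeLattice {r : Pi01Class → Pi01Class → Prop} (h : IsLatticeReducibility r) :
    Lattice (Quotient (degreeSetoid h)) where
  le := Quotient.lift₂ r fun _ _ _ _ h1 h2 => propext
    ⟨fun hr => h.trans _ _ _ h1.2 (h.trans _ _ _ hr h2.1),
      fun hr => h.trans _ _ _ h1.1 (h.trans _ _ _ hr h2.2)⟩
  le_refl := by
    rintro ⟨C⟩
    exact h.refl C
  le_trans := by
    rintro ⟨C⟩ ⟨D⟩ ⟨E⟩ h1 h2
    exact h.trans C D E h1 h2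
  le_antisymm := by
    rintro ⟨C⟩ ⟨D⟩ h1 h2
    exact Quotient.sound ⟨h1, h2⟩
  inf := Quotient.map₂ Pi01Class.inf fun C C' h1 D D' h2 =>
    ⟨h.le_inf _ _ _ (h.trans _ _ _ (h.inf_left C D) h1.1) (h.trans _ _ _ (h.inf_right C D) h2.1),
      h.le_inf _ _ _ (h.trans _ _ _ (h.inf_left C' D') h1.2)
        (h.trans _ _ _ (h.inf_right C' D') h2.2)⟩
  sup := Quotient.map₂ Pi01Class.sup fun C C' h1 D D' h2 =>
    ⟨h.sup_le _ _ _ (h.trans _ _ _ h1.1 (h.sup_left C' D')) (h.trans _ _ _ h2.1 (h.sup_right C' D')),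
      h.sup_le _ _ _ (h.trans _ _ _ h1.2 (h.sup_left C D)) (h.trans _ _ _ h2.2 (h.sup_right C D))⟩
  inf_le_left := by
    rintro ⟨C⟩ ⟨D⟩
    exact h.inf_left C D
  inf_le_right := by
    rintro ⟨C⟩ ⟨D⟩
    exact h.inf_right C D
  le_inf := by
    rintro ⟨E⟩ ⟨C⟩ ⟨D⟩ h1 h2
    exact h.le_inf C D E h1 h2
  le_sup_left := by
    rintro ⟨C⟩ ⟨D⟩
    exact h.sup_left C D
  le_sup_right := by
    rintro ⟨C⟩ ⟨D⟩
    exact h.sup_right C D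
  sup_le := by
    rintro ⟨C⟩ ⟨D⟩ ⟨E⟩ h1 h2
    exact h.sup_le C D E h1 h2

/-- The Medvedev degrees of `Π⁰₁` classes. -/
def MedvedevDegree : Type := Quotient (degreeSetoid medvedev_isLatticeReducibility)

/-- The Muchnik degrees of `Π⁰₁` classes. -/
def MuchnikDegree : Type := Quotient (degreeSetoid muchnik_isLatticeReducibility)

instance : Lattice MedvedevDegree := degreeLattice medvedev_isLatticeReducibility

instance : Lattice MuchnikDegree := degreeLattice muchnik_isLatticeReducibility

/-- The Medvedev degree of a `Π⁰₁` class. -/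
def medvedevDeg (C : Pi01Class) : MedvedevDegree :=
  Quotient.mk (degreeSetoid medvedev_isLatticeReducibility) C

/-- The Muchnik degree of a `Π⁰₁` class. -/
def muchnikDeg (C : Pi01Class) : MuchnikDegree :=
  Quotient.mk (degreeSetoid muchnik_isLatticeReducibility) C

theorem medvedevDeg_le (C D : Pi01Class) : medvedevDeg C ≤ medvedevDeg D ↔ MedvedevLE C D :=
  Iff.rfl

theorem muchnikDeg_le (C D : Pi01Class) : muchnikDeg C ≤ muchnikDeg D ↔ MuchnikLE C D :=
  Iff.rfl

theorem medvedevDeg_inf (C D : Pi01Class) :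
    medvedevDeg C ⊓ medvedevDeg D = medvedevDeg (C.inf D) := rfl

theorem muchnikDeg_inf (C D : Pi01Class) :
    muchnikDeg C ⊓ muchnikDeg D = muchnikDeg (C.inf D) := rfl

/-- A filter in a lattice: a nonempty, upward closed set which is closed under `⊓`. -/
def IsLatticeFilter {L : Type*} [Lattice L] (F : Set L) : Prop :=
  F.Nonempty ∧ (∀ x y, x ∈ F → x ≤ y → y ∈ F) ∧ ∀ x y, x ∈ F → y ∈ F → x ⊓ y ∈ F

end MassProblems

/-!
Depth is an effective form of negligibility. A `Π⁰₁` class `C` is the decreasing limit of clopen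
classes whose measure is computable, uniformly in the stage. If `C` is null, then a stage at which
the measure is below `2 ^ (-k)` can therefore be computed from `k`, and a slowly growing inverse of
this modulus is the order witnessing depth.

Negligibility passes from `C` to every `D ≥_w C` by forcing with `Π⁰₁` classes of positive
`μ`-measure, for a fixed computable `μ`. Let `D` be such a class and `Φ` a Turing functional. If for
some `n` the bit `Φ(X)(n)` diverges on a positive-measure part of `D`, then this part is again a
`Π⁰₁` class, and it is disjoint from `dom Φ`. Otherwise one can compute stages by which all bits
converge outside of a set of measure less than `μ D`, so on a `Π⁰₁` class `E ⊆ D` of positive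
measure `Φ` is a truth-table functional `F`. The image of `μ` under `F` is computable, hence
`F⁻¹(C)` is null and `E ∩ F⁻¹⟦σ⟧` has positive measure for some `⟦σ⟧` disjoint from `C`. There are
only countably many `Φ`, so compactness yields an `X ∈ D` which no `Φ` maps into `C`.
-/

namespace MassProblems

section Computability

variable {α : Type*} [Primcodable α]

theorem computable_two_pow {f : α → ℕ} (hf : Computable f) : Computable fun a => 2 ^ f a :=
  (Primrec₂.unpaired'.1 Nat.Primrec.pow).to_comp.comp (Computable.const 2) hf

theorem computable_decide_eq {β : Type*} [Primcodable β] [DecidableEq β] {f g : α → β}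
    (hf : Computable f) (hg : Computable g) : Computable fun a => decide (f a = g a) :=
  Primrec.eq.decide.to_comp.comp hf hg

theorem computable_decide_lt {f g : α → ℕ} (hf : Computable f) (hg : Computable g) :
    Computable fun a => decide (f a < g a) :=
  Primrec.nat_lt.decide.to_comp.comp hf hg

theorem computable_sum_range {f : α → ℕ → ℕ} {n : α → ℕ} (hf : Computable₂ f)
    (hn : Computable n) : Computable fun a => ∑ k ∈ Finset.range (n a), f a k := by
  have step : Computable₂ fun (a : α) (p : ℕ × ℕ) => p.2 + f a p.1 :=
    (Primrec.nat_add.to_comp.comp (Computable.snd.comp Computable.snd)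
      (hf.comp Computable.fst (Computable.fst.comp Computable.snd))).to₂
  refine (Computable.nat_rec hn (Computable.const 0) step).of_eq fun a => ?_
  induction n a with
  | zero => rfl
  | succ k ih => rw [Finset.sum_range_succ, ← ih]

theorem computable_exists_lt {p : α → ℕ → Bool} {n : α → ℕ} (hp : Computable₂ p)
    (hn : Computable n) : Computable fun a => decide (∃ k < n a, p a k = true) := by
  have step : Computable₂ fun (a : α) (q : ℕ × Bool) => q.2 || p a q.1 :=
    (Primrec.or.to_comp.comp (Computable.snd.comp Computable.snd)
      (hp.comp Computable.fst (Computable.fst.comp Computable.snd))).to₂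
  refine (Computable.nat_rec hn (Computable.const false) step).of_eq fun a => ?_
  induction n a with
  | zero => simp
  | succ k ih => simp only [ih, Nat.exists_lt_succ_right, Bool.decide_or, Bool.decide_eq_true]

theorem computable_forall_lt {p : α → ℕ → Bool} {n : α → ℕ} (hp : Computable₂ p)
    (hn : Computable n) : Computable fun a => decide (∀ k < n a, p a k = true) := by
  have hnot : Computable₂ fun a k => !p a k := Primrec.not.to_comp.comp hp
  exact (Primrec.not.to_comp.comp (computable_exists_lt hnot hn)).of_eq fun a => by
    simp [← decide_not]

theorem computable_findGreatest {p : α → ℕ → Bool} {n : α → ℕ} (hp : Computable₂ p)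
    (hn : Computable n) : Computable fun a => Nat.findGreatest (fun k => p a k = true) (n a) := by
  have hsucc : Computable fun q : α × ℕ × ℕ => q.2.1 + 1 :=
    Computable.succ.comp (Computable.fst.comp Computable.snd)
  have step : Computable₂ fun (a : α) (q : ℕ × ℕ) => bif p a (q.1 + 1) then q.1 + 1 else q.2 :=
    (Computable.cond (hp.comp Computable.fst hsucc) hsucc
      (Computable.snd.comp Computable.snd)).to₂
  refine (Computable.nat_rec hn (Computable.const 0) step).of_eq fun a => ?_
  induction n a with
  | zero => rfl
  | succ k ih => rw [Nat.findGreatest_succ, ← ih, ← cond_eq_ite]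

theorem exists_computable_choice_of_re {p : α → ℕ → Prop} (hp : REPred fun q : α × ℕ => p q.1 q.2)
    (h : ∀ a, ∃ n, p a n) : ∃ u : α → ℕ, Computable u ∧ ∀ a, p a (u a) := by
  obtain ⟨f, hf, hfp⟩ := exists_of_re hp
  let g : α → ℕ → Bool := fun a m => f (a, m.unpair.1) m.unpair.2
  have hunpair : Computable fun q : α × ℕ => q.2.unpair := Computable.unpair.comp Computable.snd
  have hg : Computable₂ g := (hf.comp (Computable.fst.pair (Computable.fst.comp hunpair))
    (Computable.snd.comp hunpair)).to₂
  have hsearch : ∀ a, ∃ m, m ∈ Nat.rfind fun m => (Part.some (g a m) : Part Bool) := fun a => by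
    obtain ⟨n, hn⟩ := h a
    obtain ⟨m, hm⟩ := (hfp (a, n)).1 hn
    exact Part.dom_iff_mem.1 <| Nat.rfind_dom.2
      ⟨Nat.pair n m, by simpa [g] using hm, fun _ => trivial⟩
  choose v hv using hsearch
  refine ⟨fun a => (v a).unpair.1, Computable.fst.comp (Computable.unpair.comp
    ((Partrec.rfind hg.partrec₂).of_eq_tot hv)), fun a => (hfp (a, _)).2 ⟨(v a).unpair.2, ?_⟩⟩
  simpa [g] using Nat.rfind_spec (hv a)

theorem countable_setOf_rePred : {S : Set α | REPred fun a => a ∈ S}.Countable := by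
  have hcode : ∀ S : {S : Set α | REPred fun a => a ∈ S}, ∃ c : Nat.Partrec.Code,
      ∀ a, a ∈ S.1 ↔ (c.eval (Encodable.encode a)).Dom := fun ⟨S, hS⟩ => by
    obtain ⟨c, hc⟩ := Nat.Partrec.Code.exists_code.1 hS
    exact ⟨c, fun a => by simp [hc, Part.assert]⟩
  choose c hc using hcode
  have hinj : Function.Injective c := fun S T h =>
    Subtype.ext <| Set.ext fun a => by rw [hc, hc, h]
  exact Set.countable_coe_iff.1 hinj.countable

end Computability

section UniformlyComputable

variable {α β : Type*} [Primcodable α] [Primcodable β]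

/-- The non-negative reals `r a` are uniformly computable: from `a` and `i` one can compute a dyadic
rational `num a i / 2 ^ exp a i` within `2 ^ (-i)` of `r a`. Natural numerators are no restriction
for non-negative reals, and `IsComputableMeasure` uses the same encoding. -/
def UniformlyComputable (r : α → ℝ) : Prop :=
  ∃ num exp : α → ℕ → ℕ, Computable₂ num ∧ Computable₂ exp ∧
    ∀ a i, |r a - (num a i : ℝ) / 2 ^ exp a i| ≤ (2 : ℝ)⁻¹ ^ i

theorem isComputableMeasure_iff {μ : Measure Cantor} : IsComputableMeasure μ ↔
    IsFiniteMeasure μ ∧ UniformlyComputable fun σ => μ.real (cylinder σ) := Iff.rfl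

theorem abs_sum_range_sub_le {x y : ℕ → ℝ} {n i : ℕ}
    (h : ∀ k ∈ Finset.range n, |x k - y k| ≤ (2 : ℝ)⁻¹ ^ (i + n)) :
    |∑ k ∈ Finset.range n, x k - ∑ k ∈ Finset.range n, y k| ≤ (2 : ℝ)⁻¹ ^ i := by
  rw [← Finset.sum_sub_distrib]
  calc |∑ k ∈ Finset.range n, (x k - y k)|
      ≤ ∑ _ ∈ Finset.range n, (2 : ℝ)⁻¹ ^ (i + n) :=
        (Finset.abs_sum_le_sum_abs _ _).trans (Finset.sum_le_sum h)
    _ = (2 : ℝ)⁻¹ ^ i * (n * (2 : ℝ)⁻¹ ^ n) := by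
        rw [Finset.sum_const, Finset.card_range, nsmul_eq_mul, pow_add, mul_left_comm]
    _ ≤ (2 : ℝ)⁻¹ ^ i := by
        refine mul_le_of_le_one_right (by positivity) ?_
        rw [inv_pow, ← div_eq_mul_inv]
        exact div_le_one_of_le₀ (mod_cast Nat.lt_two_pow_self.le) (by positivity)

namespace UniformlyComputable

theorem comp {r : β → ℝ} (hr : UniformlyComputable r) {f : α → β} (hf : Computable f) :
    UniformlyComputable fun a => r (f a) := by
  obtain ⟨num, exp, hnum, hexp, happrox⟩ := hr
  have hf' : Computable fun p : α × ℕ => f p.1 := hf.comp Computable.fst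
  exact ⟨_, _, (hnum.comp hf' Computable.snd).to₂, (hexp.comp hf' Computable.snd).to₂,
    fun a => happrox (f a)⟩

theorem ite {r : α → ℝ} (hr : UniformlyComputable r) {p : α → Bool} (hp : Computable p) :
    UniformlyComputable fun a => if p a = true then r a else 0 := by
  obtain ⟨num, exp, hnum, hexp, happrox⟩ := hr
  refine ⟨fun a i => bif p a then num a i else 0, exp,
    (Computable.cond (hp.comp Computable.fst) hnum (Computable.const 0)).to₂, hexp, fun a i => ?_⟩
  cases hpa : p a with
  | true => simpa [hpa] using happrox a i
  | false => simp [hpa]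

theorem inv_two_pow {k : α → ℕ} (hk : Computable k) :
    UniformlyComputable fun a => (2 : ℝ)⁻¹ ^ k a :=
  ⟨fun _ _ => 1, fun a _ => k a, Computable.const 1, (hk.comp Computable.fst).to₂,
    fun a i => by simp⟩

/- The approximations are added over the common denominator `2 ^ ∑ exp`, and `n a ≤ 2 ^ n a` makes
`n a` additional bits of precision enough. -/
theorem sum_range {r : α × ℕ → ℝ} (hr : UniformlyComputable r) {n : α → ℕ} (hn : Computable n) :
    UniformlyComputable fun a => ∑ k ∈ Finset.range (n a), r (a, k) := by
  obtain ⟨num, exp, hnum, hexp, happrox⟩ := hr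
  let e : α × ℕ → ℕ → ℕ := fun p k => exp (p.1, k) (p.2 + n p.1)
  let E : α × ℕ → ℕ := fun p => ∑ k ∈ Finset.range (n p.1), e p k
  let N : α × ℕ → ℕ → ℕ := fun p k => num (p.1, k) (p.2 + n p.1) * 2 ^ (E p - e p k)
  have hn' : Computable fun p : α × ℕ => n p.1 := hn.comp Computable.fst
  have hindex : Computable fun q : (α × ℕ) × ℕ => (q.1.1, q.2) :=
    (Computable.fst.comp Computable.fst).pair Computable.snd
  have hprec : Computable fun q : (α × ℕ) × ℕ => q.1.2 + n q.1.1 := Primrec.nat_add.to_comp.comp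
    (Computable.snd.comp Computable.fst) (hn'.comp Computable.fst)
  have he : Computable₂ e := (hexp.comp hindex hprec).to₂
  have hE : Computable E := computable_sum_range he hn'
  have hN : Computable₂ N := (Primrec.nat_mul.to_comp.comp (hnum.comp hindex hprec)
    (computable_two_pow (Primrec.nat_sub.to_comp.comp (hE.comp Computable.fst) he))).to₂
  have hN_div : ∀ p, ∀ k ∈ Finset.range (n p.1),
      (N p k : ℝ) / 2 ^ E p = num (p.1, k) (p.2 + n p.1) / 2 ^ e p k := fun p k hk => by
    have hle : e p k ≤ E p := Finset.single_le_sum (fun _ _ => Nat.zero_le _) hk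
    rw [div_eq_div_iff (by positivity) (by positivity), Nat.cast_mul, Nat.cast_pow, Nat.cast_ofNat,
      mul_assoc, ← pow_add, Nat.sub_add_cancel hle]
  refine ⟨fun a i => ∑ k ∈ Finset.range (n a), N (a, i) k, fun a i => E (a, i),
    (computable_sum_range hN hn').to₂, hE.to₂, fun a i => ?_⟩
  rw [Nat.cast_sum, Finset.sum_div]
  exact abs_sum_range_sub_le fun k hk => hN_div (a, i) k hk ▸ happrox (a, k) _

theorem re_lt {r r' : α → ℝ} (hr : UniformlyComputable r) (hr' : UniformlyComputable r') :
    REPred fun a => r a < r' a := by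
  obtain ⟨num, exp, hnum, hexp, happrox⟩ := hr
  obtain ⟨num', exp', hnum', hexp', happrox'⟩ := hr'
  have hcertificate : ∀ a, r a < r' a ↔
      ∃ i, (num a i : ℝ) / 2 ^ exp a i + 2 / 2 ^ i < num' a i / 2 ^ exp' a i := fun a => by
    constructor
    · intro h
      obtain ⟨i, hi⟩ := exists_pow_lt_of_lt_one (sub_pos.2 h) (by norm_num : (2 : ℝ)⁻¹ < 1)
      refine ⟨i + 2, ?_⟩
      have := abs_le.1 (happrox a (i + 2))
      have := abs_le.1 (happrox' a (i + 2))
      rw [div_eq_mul_inv 2, ← inv_pow]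
      simp only [pow_add] at *
      linarith
    · rintro ⟨i, hi⟩
      have := abs_le.1 (happrox a i)
      have := abs_le.1 (happrox' a i)
      rw [div_eq_mul_inv 2, ← inv_pow] at hi
      linarith
  have hclear : ∀ a i, (num a i : ℝ) / 2 ^ exp a i + 2 / 2 ^ i < num' a i / 2 ^ exp' a i ↔
      (num a i * 2 ^ i + 2 * 2 ^ exp a i) * 2 ^ exp' a i <
        num' a i * (2 ^ exp a i * 2 ^ i) := fun a i => by
    rw [div_add_div _ _ (by positivity) (by positivity),
      div_lt_div_iff₀ (by positivity) (by positivity), mul_comm ((2 : ℝ) ^ exp a i) 2]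
    exact_mod_cast Iff.rfl
  have hpow : Computable fun p : α × ℕ => 2 ^ p.2 := computable_two_pow Computable.snd
  have hmul {f g : α × ℕ → ℕ} (hf : Computable f) (hg : Computable g) :
      Computable fun p => f p * g p := Primrec.nat_mul.to_comp.comp hf hg
  refine re_of_exists (computable_decide_lt
    (hmul (Primrec.nat_add.to_comp.comp (hmul hnum hpow)
      (hmul (Computable.const 2) (computable_two_pow hexp))) (computable_two_pow hexp'))
    (hmul hnum' (hmul (computable_two_pow hexp) hpow))).to₂ fun a => ?_
  simp only [hcertificate, hclear, decide_eq_true_eq]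

theorem exists_computable_modulus {r : α × ℕ → ℝ} (hr : UniformlyComputable r)
    (hlim : ∀ a, Tendsto (fun n => r (a, n)) atTop (nhds 0)) {k : α → ℕ} (hk : Computable k) :
    ∃ u : α → ℕ, Computable u ∧ ∀ a, r (a, u a) < (2 : ℝ)⁻¹ ^ k a :=
  exists_computable_choice_of_re (hr.re_lt (inv_two_pow (hk.comp Computable.fst))) fun a =>
    ((hlim a).eventually_lt_const (by positivity)).exists

end UniformlyComputable

end UniformlyComputable

section Restr

variable {X Y : Cantor} {σ : List Bool} {m n s : ℕ}

theorem take_restr (h : m ≤ n) : (restr X n).take m = restr X m := by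
  simpa using (List.prefix_iff_eq_take.1 (restr_prefix X h)).symm

theorem restr_eq_restr_iff : restr X n = restr Y n ↔ ∀ i < n, X i = Y i := by
  simp [restr, List.map_inj_left]

theorem mem_cylinder_iff_restr_eq (h : σ.length = n) : X ∈ cylinder σ ↔ restr X n = σ :=
  h ▸ Iff.rfl

theorem mem_biUnion_cylinder_iff {S : Set (List Bool)} :
    X ∈ ⋃ σ ∈ S, cylinder σ ↔ ∃ n, restr X n ∈ S := by
  simp only [mem_iUnion, exists_prop]
  constructor
  · rintro ⟨σ, hσ, hX⟩
    exact ⟨σ.length, ((mem_cylinder_iff_restr_eq rfl).1 hX).symm ▸ hσ⟩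
  · rintro ⟨n, hn⟩
    exact ⟨_, hn, mem_cylinder_restr X n⟩

theorem exists_restr_testBit_eq (X : Cantor) (n : ℕ) :
    ∃ k < 2 ^ n, restr k.testBit n = restr X n := by
  let f : Fin n → Bool := fun i => X i
  exact ⟨Nat.ofBits f, Nat.ofBits_lt_two_pow f,
    restr_eq_restr_iff.2 fun i hi => Nat.testBit_ofBits_lt f i hi⟩

theorem injOn_restr_testBit (n : ℕ) :
    InjOn (fun k : ℕ => restr k.testBit n) (Finset.range (2 ^ n)) := by
  have hhigh : ∀ k ∈ Finset.range (2 ^ n), ∀ i, n ≤ i → k.testBit i = false := fun k hk i hi =>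
    Nat.testBit_lt_two_pow
      ((Finset.mem_range.1 hk).trans_le (Nat.pow_le_pow_right Nat.two_pos hi))
  intro j hj k hk h
  refine Nat.eq_of_testBit_eq fun i => ?_
  rcases lt_or_ge i n with hi | hi
  · exact restr_eq_restr_iff.1 h i hi
  · rw [hhigh j hj i hi, hhigh k hk i hi]

theorem computable_restr_testBit : Computable₂ fun n k : ℕ => restr k.testBit n := by
  have hpow : Primrec fun q : (ℕ × ℕ) × ℕ => 2 ^ q.2 :=
    (Primrec₂.unpaired'.1 Nat.Primrec.pow).comp (Primrec.const 2) Primrec.snd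
  have hbit : Primrec₂ fun (p : ℕ × ℕ) (i : ℕ) => p.2.testBit i :=
    (Primrec.eq.decide.comp (Primrec.nat_mod.comp
      (Primrec.nat_div.comp (Primrec.snd.comp Primrec.fst) hpow) (Primrec.const 2))
      (Primrec.const 1)).of_eq fun q => Nat.testBit_eq_decide_div_mod_eq.symm
  exact (Primrec.list_map (Primrec.list_range.comp Primrec.fst) hbit).to_comp

theorem isLocallyConstant_restr (n : ℕ) : IsLocallyConstant fun X : Cantor => restr X n := by
  rw [IsLocallyConstant.iff_eventually_eq]
  intro X
  have hbit : ∀ i ∈ Finset.range n, ∀ᶠ Y : Cantor in nhds X, Y i = X i := fun i _ =>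
    (continuous_apply i).continuousAt.eventually ((isOpen_discrete {X i}).mem_nhds rfl)
  filter_upwards [(Finset.eventually_all _).2 hbit] with Y hY
  exact restr_eq_restr_iff.2 fun i hi => hY i (Finset.mem_range.2 hi)

theorem isClopen_setOf_restr (p : List Bool → Prop) (n : ℕ) :
    IsClopen {X : Cantor | p (restr X n)} :=
  ⟨isOpen_compl_iff.1 (isLocallyConstant_restr n {σ | p σ}ᶜ), isLocallyConstant_restr n {σ | p σ}⟩

theorem isClopen_cylinder (σ : List Bool) : IsClopen (cylinder σ) :=
  isClopen_setOf_restr (fun τ => τ = σ) σ.length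

theorem measurableSet_setOf_restr (p : List Bool → Prop) (n : ℕ) :
    MeasurableSet {X : Cantor | p (restr X n)} :=
  (isClopen_setOf_restr p n).isOpen.measurableSet

theorem measurableSet_cylinder (σ : List Bool) : MeasurableSet (cylinder σ) :=
  (isClopen_cylinder σ).isOpen.measurableSet

end Restr

section Stages

variable {α : Type*} [Primcodable α]

theorem exists_stages_of_re {p : α → List Bool → Prop}
    (hp : REPred fun q : α × List Bool => p q.1 q.2) :
    ∃ T : α → List Bool → Bool, Computable₂ T ∧ (∀ a X, Monotone fun s => T a (restr X s)) ∧
      ∀ a X, (∃ s, T a (restr X s) = true) ↔ ∃ n, p a (restr X n) := by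
  obtain ⟨f, hf, hfp⟩ := exists_of_re hp
  let g : α × List Bool → ℕ → Bool := fun q k => f (q.1, q.2.take k.unpair.1) k.unpair.2
  have hunpair : Computable fun r : (α × List Bool) × ℕ => r.2.unpair :=
    Computable.unpair.comp Computable.snd
  have htake : Computable fun r : (α × List Bool) × ℕ => r.1.2.take r.2.unpair.1 :=
    Primrec.list_take.to_comp.comp (Computable.fst.comp hunpair)
      (Computable.snd.comp Computable.fst)
  have hg : Computable₂ g := (hf.comp ((Computable.fst.comp Computable.fst).pair htake)
    (Computable.snd.comp hunpair)).to₂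
  have hg_restr : ∀ a X s, (∃ k < (restr X s).length, g (a, restr X s) k = true) ↔
      ∃ k < s, f (a, restr X k.unpair.1) k.unpair.2 = true := fun a X s => by
    rw [length_restr]
    refine exists_congr fun k => and_congr_right fun hk => ?_
    rw [← take_restr ((Nat.unpair_left_le k).trans hk.le)]
  refine ⟨fun a σ => decide (∃ k < σ.length, g (a, σ) k = true),
    (computable_exists_lt hg (Computable.list_length.comp Computable.snd)).to₂,
    fun a X s s' hs => ?_, fun a X => ?_⟩
  · simp only [Bool.le_iff_imp, decide_eq_true_eq, hg_restr]
    exact fun ⟨k, hk, hfk⟩ => ⟨k, hk.trans_le hs, hfk⟩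
  · simp only [decide_eq_true_eq, hg_restr, fun n => hfp (a, restr X n)]
    constructor
    · rintro ⟨-, k, -, hk⟩
      exact ⟨k.unpair.1, k.unpair.2, hk⟩
    · rintro ⟨n, m, hm⟩
      exact ⟨_, Nat.pair n m, Nat.lt_succ_self _, by rwa [Nat.unpair_pair]⟩

theorem isPi01_setOf_forall_restr {q : ℕ → List Bool → Bool} (hq : Computable₂ q) {u : ℕ → ℕ}
    (hu : Computable u) : IsPi01 {X | ∀ n, q n (restr X (u n)) = true} := by
  let f : List Bool → ℕ → Bool := fun σ n => decide (σ.length = u n) && !q n σ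
  have hf : Computable₂ f := Primrec.and.to_comp.comp
    (computable_decide_eq (Computable.list_length.comp Computable.fst) (hu.comp Computable.snd))
    (Primrec.not.to_comp.comp (hq.comp Computable.snd Computable.fst))
  refine ⟨{σ | ∃ n, f σ n = true}, re_of_exists hf fun σ => Iff.rfl, Set.ext fun X => ?_⟩
  rw [mem_biUnion_cylinder_iff]
  simp only [mem_compl_iff, mem_ofPred_eq, not_forall, f, length_restr, Bool.and_eq_true,
    decide_eq_true_eq, Bool.not_eq_true, Bool.not_eq_true']
  exact ⟨fun ⟨n, hn⟩ => ⟨_, n, rfl, hn⟩, fun ⟨_, n, hm, hn⟩ => ⟨n, hm ▸ hn⟩⟩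

theorem isPi01_empty : IsPi01 ∅ := by
  simpa using isPi01_setOf_forall_restr (q := fun _ _ => false) (Computable.const false).to₂
    Computable.id

variable {C D : Set Cantor}

theorem IsPi01.exists_tree (hC : IsPi01 C) : ∃ t : List Bool → Bool, Computable t ∧
    (∀ X, Antitone fun s => t (restr X s)) ∧ C = {X | ∀ s, t (restr X s) = true} := by
  obtain ⟨S, hS, hSC⟩ := hC
  obtain ⟨T, hT, hmono, hTS⟩ := exists_stages_of_re (p := fun (_ : Unit) σ => σ ∈ S)
    (re_comp hS Computable.snd)
  refine ⟨fun σ => !T () σ, Primrec.not.to_comp.comp (hT.comp (Computable.const ()) Computable.id),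
    fun X s s' hs => ?_, Set.ext fun X => ?_⟩
  · exact compl_le_compl (hmono () X hs)
  · rw [← notMem_compl_iff, hSC, mem_biUnion_cylinder_iff, ← hTS () X]
    simp

theorem IsPi01.inter (hC : IsPi01 C) (hD : IsPi01 D) : IsPi01 (C ∩ D) := by
  obtain ⟨t, ht, -, rfl⟩ := hC.exists_tree
  obtain ⟨t', ht', -, rfl⟩ := hD.exists_tree
  simpa [ofPred_and, forall_and] using
    isPi01_setOf_forall_restr (q := fun _ σ => t σ && t' σ) (Primrec.and.to_comp.comp
      (ht.comp Computable.snd) (ht'.comp Computable.snd)).to₂ Computable.id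

theorem IsPi01.isClosed (hC : IsPi01 C) : IsClosed C := by
  obtain ⟨S, -, hS⟩ := hC
  rw [← isOpen_compl_iff, hS]
  exact isOpen_biUnion fun σ _ => (isClopen_cylinder σ).isOpen

theorem IsPi01.exists_cylinder_disjoint (hC : IsPi01 C) {X : Cantor} (hX : X ∉ C) :
    ∃ σ, X ∈ cylinder σ ∧ Disjoint (cylinder σ) C := by
  obtain ⟨S, -, hS⟩ := hC
  rw [← mem_compl_iff, hS] at hX
  obtain ⟨σ, hσ, hXσ⟩ := mem_iUnion₂.1 hX
  exact ⟨σ, hXσ, disjoint_left.2 fun Y hY => by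
    rw [← mem_compl_iff, hS]; exact mem_biUnion hσ hY⟩

end Stages

section Measure

variable {α : Type*} [Primcodable α] {μ : Measure Cantor}

theorem measureReal_setOf_restr (μ : Measure Cantor) [IsFiniteMeasure μ] (p : List Bool → Bool)
    (n : ℕ) : μ.real {X | p (restr X n) = true} = ∑ k ∈ Finset.range (2 ^ n),
      if p (restr k.testBit n) = true then μ.real (cylinder (restr k.testBit n)) else 0 := by
  have hmem : ∀ (X : Cantor) (k : ℕ), X ∈ cylinder (restr k.testBit n) ↔
      restr X n = restr k.testBit n := fun X k => mem_cylinder_iff_restr_eq (length_restr _ n)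
  rw [← Finset.sum_filter, ← measureReal_biUnion_finset]
  · congr 1
    ext X
    simp only [mem_ofPred_eq, mem_iUnion, Finset.mem_filter, Finset.mem_range, exists_prop, hmem]
    constructor
    · intro hX
      obtain ⟨k, hk, hkX⟩ := exists_restr_testBit_eq X n
      exact ⟨k, ⟨hk, hkX ▸ hX⟩, hkX.symm⟩
    · rintro ⟨k, ⟨-, hk⟩, hkX⟩
      exact hkX ▸ hk
  · intro j hj k hk hjk
    refine disjoint_left.2 fun X hXj hXk => hjk ?_
    exact injOn_restr_testBit n (Finset.mem_filter.1 hj).1 (Finset.mem_filter.1 hk).1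
      (((hmem X j).1 hXj).symm.trans ((hmem X k).1 hXk))
  · exact fun k _ => measurableSet_cylinder _

theorem tendsto_measureReal_setOf_restr (μ : Measure Cantor) [IsFiniteMeasure μ]
    {p : List Bool → Bool} (hp : ∀ X, Antitone fun s => p (restr X s)) :
    Tendsto (fun s => μ.real {X | p (restr X s) = true}) atTop
      (nhds (μ.real {X | ∀ s, p (restr X s) = true})) := by
  have hInter : {X | ∀ s, p (restr X s) = true} = ⋂ s, {X | p (restr X s) = true} :=
    Set.ext fun X => by simp
  rw [hInter]
  exact (ENNReal.tendsto_toReal (measure_ne_top _ _)).comp <| tendsto_measure_iInter_atTop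
    (fun s => (measurableSet_setOf_restr (fun σ => p σ = true) s).nullMeasurableSet)
    (fun s s' hs X hX => Bool.le_iff_imp.1 (hp X hs) hX) ⟨0, measure_ne_top _ _⟩

namespace IsComputableMeasure

theorem uniformlyComputable_setOf_restr (hμ : IsComputableMeasure μ) {P : α → List Bool → Bool}
    (hP : Computable₂ P) {s : α → ℕ} (hs : Computable s) :
    UniformlyComputable fun a => μ.real {X | P a (restr X (s a)) = true} := by
  have := hμ.1
  have hstring : Computable fun q : α × ℕ => restr q.2.testBit (s q.1) :=
    computable_restr_testBit.comp (hs.comp Computable.fst) Computable.snd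
  have hsum := (((isComputableMeasure_iff.1 hμ).2.comp hstring).ite
    (hP.comp Computable.fst hstring)).sum_range (computable_two_pow hs)
  simpa only [measureReal_setOf_restr] using hsum

theorem exists_stage (hμ : IsComputableMeasure μ) {P : α → List Bool → Bool} (hP : Computable₂ P)
    (hanti : ∀ a X, Antitone fun s => P a (restr X s))
    (hnull : ∀ a, μ {X | ∀ s, P a (restr X s) = true} = 0) {k : α → ℕ} (hk : Computable k) :
    ∃ u : α → ℕ, Computable u ∧
      ∀ a, μ {X | P a (restr X (u a)) = true} < (2 : ℝ≥0∞)⁻¹ ^ k a := by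
  have := hμ.1
  have hUC : UniformlyComputable fun q : α × ℕ => μ.real {X | P q.1 (restr X q.2) = true} :=
    hμ.uniformlyComputable_setOf_restr (P := fun q : α × ℕ => P q.1)
      (hP.comp (Computable.fst.comp Computable.fst) Computable.snd).to₂ Computable.snd
  obtain ⟨u, hu, hlt⟩ := hUC.exists_computable_modulus (fun a => by
    simpa [Measure.real, hnull a] using tendsto_measureReal_setOf_restr μ (hanti a)) hk
  refine ⟨u, hu, fun a => ?_⟩
  rw [← ENNReal.toReal_lt_toReal (measure_ne_top _ _) (by simp)]
  simpa [Measure.real] using hlt a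

end IsComputableMeasure

end Measure

section TTDeep

variable {C D : Set Cantor}

theorem measure_le_stringMass (μ : Measure Cantor) (C : Set Cantor) (n : ℕ) :
    μ C ≤ stringMass μ (treeLevel (canonicalTree C) n) := by
  refine (measure_mono fun X hX => ?_).trans (measure_iUnion_le _)
  exact mem_iUnion.2 ⟨⟨restr X n, ⟨X, mem_cylinder_restr X n, hX⟩, length_restr X n⟩,
    mem_cylinder_restr X n⟩

theorem stringMass_le (μ : Measure Cantor) {p : List Bool → Prop} {n : ℕ}
    (h : ∀ X ∈ C, p (restr X n)) :
    stringMass μ (treeLevel (canonicalTree C) n) ≤ μ {X | p (restr X n)} := by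
  rw [stringMass, ← measure_iUnion]
  · refine measure_mono (iUnion_subset ?_)
    rintro ⟨σ, ⟨Y, hYσ, hYC⟩, hσ⟩ X hXσ
    have hXY : restr X n = restr Y n := ((mem_cylinder_iff_restr_eq hσ).1 hXσ).trans
      ((mem_cylinder_iff_restr_eq hσ).1 hYσ).symm
    exact (congrArg p hXY).mpr (h Y hYC)
  · rintro ⟨σ, _, hσ⟩ ⟨τ, _, hτ⟩ hne
    refine disjoint_left.2 fun X hXσ hXτ => hne (Subtype.ext ?_)
    exact ((mem_cylinder_iff_restr_eq hσ).1 hXσ).symm.trans ((mem_cylinder_iff_restr_eq hτ).1 hXτ)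
  · exact fun σ => measurableSet_cylinder _

theorem exists_inv_two_pow_lt {a : ℝ≥0∞} (ha : a ≠ 0) : ∃ k : ℕ, (2 : ℝ≥0∞)⁻¹ ^ k < a :=
  ((ENNReal.tendsto_pow_atTop_nhds_zero_of_lt_one (by norm_num)).eventually_lt_const
    (pos_iff_ne_zero.2 ha)).exists

theorem TTDeep.ttNegligible (hC : TTDeep C) : TTNegligible C := by
  intro μ hμ
  obtain ⟨h, ⟨-, hmono, hunbounded⟩, hdeep⟩ := hC μ hμ
  by_contra hpos
  obtain ⟨k, hk⟩ := exists_inv_two_pow_lt hpos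
  obtain ⟨m, hm⟩ := hunbounded k
  obtain ⟨n, hn, hmn⟩ := (hdeep.and (eventually_ge_atTop m)).exists
  refine lt_irrefl (μ C) ?_
  calc μ C ≤ stringMass μ (treeLevel (canonicalTree C) n) := measure_le_stringMass μ C n
    _ < (2 : ℝ≥0∞)⁻¹ ^ h n := hn
    _ ≤ (2 : ℝ≥0∞)⁻¹ ^ k := pow_le_pow_right_of_le_one' (by norm_num) (hm.trans (hmono hmn))
    _ < μ C := hk

theorem exists_isComputableOrder_eventually_le {g : ℕ → ℕ} (hg : Computable g) :
    ∃ h : ℕ → ℕ, IsComputableOrder h ∧ ∀ᶠ n in atTop, g (h n) ≤ n := by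
  let p : ℕ → ℕ → Bool := fun n k => decide (g k < n + 1)
  have hp : Computable₂ p := computable_decide_lt (hg.comp Computable.snd)
    (Computable.succ.comp Computable.fst)
  have hp_iff : ∀ n k, p n k = true ↔ g k ≤ n := fun n k => by simp [p]
  refine ⟨fun n => Nat.findGreatest (fun k => p n k = true) n,
    ⟨computable_findGreatest hp Computable.id, fun m n hmn => ?_, fun k => ⟨max k (g k), ?_⟩⟩,
    eventually_atTop.2 ⟨g 0, fun n hn => ?_⟩⟩
  · exact Nat.findGreatest_mono (fun k hk => (hp_iff n k).2 (((hp_iff m k).1 hk).trans hmn)) hmn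
  · exact Nat.le_findGreatest (le_max_left _ _) ((hp_iff _ _).2 (le_max_right _ _))
  · exact (hp_iff _ _).1 (Nat.findGreatest_spec (P := fun k => p n k = true) (Nat.zero_le n)
      ((hp_iff n 0).2 hn))

theorem IsPi01.ttDeep (hC : IsPi01 C) (hneg : TTNegligible C) : TTDeep C := by
  intro μ hμ
  obtain ⟨t, ht, hanti, rfl⟩ := hC.exists_tree
  obtain ⟨g, hg, hgμ⟩ := hμ.exists_stage (P := fun _ : ℕ => t) (ht.comp Computable.snd).to₂
    (fun _ => hanti) (fun _ => hneg μ hμ) Computable.id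
  obtain ⟨h, hh, hgh⟩ := exists_isComputableOrder_eventually_le hg
  refine ⟨h, hh, hgh.mono fun n hn => ?_⟩
  calc stringMass μ (treeLevel (canonicalTree {X | ∀ s, t (restr X s) = true}) n)
      ≤ μ {X | t (restr X n) = true} := stringMass_le μ (p := fun σ => t σ = true) fun X hX => hX n
    _ ≤ μ {X | t (restr X (g (h n))) = true} :=
        measure_mono fun X hX => Bool.le_iff_imp.1 (hanti X hn) hX
    _ < (2 : ℝ≥0∞)⁻¹ ^ h n := hgμ (h n)

theorem IsPi01.ttDeep_iff (hC : IsPi01 C) : TTDeep C ↔ TTNegligible C :=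
  ⟨TTDeep.ttNegligible, hC.ttDeep⟩

end TTDeep

section TTFunctional

/-- A truth-table functional: a map of Cantor space whose bit `n` is computed from the first `u n`
bits of the argument, for a computable use `u`. Unlike a Turing functional it is total. -/
def IsTTFunctional (F : Cantor → Cantor) : Prop :=
  ∃ (u : ℕ → ℕ) (b : ℕ → List Bool → Bool), Computable u ∧ Computable₂ b ∧
    ∀ X n, F X n = b n (restr X (u n))

variable {F : Cantor → Cantor} {μ : Measure Cantor} {C D : Set Cantor}

namespace IsTTFunctional

theorem exists_mem_cylinder_iff (hF : IsTTFunctional F) :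
    ∃ (P : List Bool → List Bool → Bool) (U : List Bool → ℕ), Computable₂ P ∧ Computable U ∧
      ∀ τ X, F X ∈ cylinder τ ↔ P τ (restr X (U τ)) = true := by
  obtain ⟨u, b, hu, hb, hFb⟩ := hF
  let U : List Bool → ℕ := fun τ => ∑ i ∈ Finset.range τ.length, u i
  let f : List Bool × List Bool → ℕ → Bool := fun q i =>
    decide (some (b i (q.2.take (u i))) = q.1[i]?)
  have hU : Computable U := computable_sum_range (hu.comp Computable.snd).to₂ Computable.list_length
  have hf : Computable₂ f := computable_decide_eq
    (Computable.option_some.comp (hb.comp Computable.snd (Primrec.list_take.to_comp.comp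
      (hu.comp Computable.snd) (Computable.snd.comp Computable.fst))))
    (Computable.list_getElem?.comp (Computable.fst.comp Computable.fst) Computable.snd)
  refine ⟨fun τ σ => decide (∀ i < τ.length, f (τ, σ) i = true), U,
    (computable_forall_lt hf (Computable.list_length.comp Computable.fst)).to₂, hU, fun τ X => ?_⟩
  have hf_iff : ∀ i < τ.length, f (τ, restr X (U τ)) i = true ↔ some (F X i) = τ[i]? :=
    fun i hi => by
      have hle : u i ≤ U τ :=
        Finset.single_le_sum (f := u) (fun _ _ => Nat.zero_le _) (Finset.mem_range.2 hi)
      rw [decide_eq_true_iff, take_restr hle, ← hFb]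
  rw [decide_eq_true_iff, mem_cylinder_iff]
  constructor
  · intro h i hi
    rw [hf_iff i hi, List.getElem?_eq_getElem hi, h i _ (List.getElem?_eq_getElem hi)]
  · intro h i c hc
    obtain ⟨hi, -⟩ := List.getElem?_eq_some_iff.1 hc
    exact Option.some_injective _ (((hf_iff i hi).1 (h i hi)).trans hc)

theorem measurable (hF : IsTTFunctional F) : Measurable F := by
  obtain ⟨u, b, -, -, hFb⟩ := hF
  refine measurable_pi_lambda _ fun n => measurable_to_bool ?_
  have hpre : (fun X => F X n) ⁻¹' {true} = {X | b n (restr X (u n)) = true} :=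
    Set.ext fun X => by rw [mem_preimage, mem_singleton_iff, hFb, mem_ofPred_eq]
  rw [hpre]
  exact measurableSet_setOf_restr (fun σ => b n σ = true) (u n)

theorem isPi01_preimage_cylinder (hF : IsTTFunctional F) (τ : List Bool) :
    IsPi01 (F ⁻¹' cylinder τ) := by
  obtain ⟨P, U, hP, -, hFP⟩ := hF.exists_mem_cylinder_iff
  simpa only [preimage, hFP, forall_const] using
    isPi01_setOf_forall_restr (q := fun _ => P τ) (hP.comp (Computable.const τ) Computable.snd).to₂
      (Computable.const (U τ))

theorem isComputableMeasure_map (hF : IsTTFunctional F) (hμ : IsComputableMeasure μ) :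
    IsComputableMeasure (μ.map F) := by
  have := hμ.1
  obtain ⟨P, U, hP, hU, hFP⟩ := hF.exists_mem_cylinder_iff
  refine isComputableMeasure_iff.2 ⟨inferInstance, ?_⟩
  simpa only [map_measureReal_apply hF.measurable (measurableSet_cylinder _), preimage, hFP]
    using hμ.uniformlyComputable_setOf_restr hP hU

end IsTTFunctional

theorem isTTFunctional_shift : IsTTFunctional fun X n => X (n + 1) := by
  refine ⟨fun n => n + 2, fun n σ => σ.getD (n + 1) false, Computable.succ.comp Computable.succ,
    (Primrec.list_getD false).to_comp.comp Computable.snd (Computable.succ.comp Computable.fst),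
    fun X n => ?_⟩
  simp [restr]

namespace TTNegligible

theorem preimage (hC : TTNegligible C) (hF : IsTTFunctional F) : TTNegligible (F ⁻¹' C) :=
  fun _ hμ => nonpos_iff_eq_zero.1 <| (Measure.le_map_apply hF.measurable.aemeasurable C).trans
    (hC _ (hF.isComputableMeasure_map hμ)).le

theorem union (hC : TTNegligible C) (hD : TTNegligible D) : TTNegligible (C ∪ D) :=
  fun μ hμ => measure_union_null (hC μ hμ) (hD μ hμ)

theorem mono (hC : TTNegligible C) (h : D ⊆ C) : TTNegligible D :=
  fun μ hμ => measure_mono_null h (hC μ hμ)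

theorem infSet (hC : TTNegligible C) (hD : TTNegligible D) : TTNegligible (infSet C D) :=
  ((hC.union hD).preimage isTTFunctional_shift).mono <| union_subset
    (image_subset_iff.2 fun _ hX => Or.inl hX) (image_subset_iff.2 fun _ hX => Or.inr hX)

end TTNegligible

end TTFunctional

section Forcing

variable {μ : Measure Cantor} {C D : Set Cantor}

/- An effective form of Egorov's theorem: `D` does not lose all of its measure, because the `n`-th
stage is chosen so that less than `2 ^ (-(K + n + 1))` is lost, where `2 ^ (-K) < μ D`. -/
theorem IsComputableMeasure.exists_uniform_stage (hμ : IsComputableMeasure μ) (hD : IsPi01 D)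
    (hpos : μ D ≠ 0) {T : ℕ → List Bool → Bool} (hT : Computable₂ T)
    (hmono : ∀ n X, Monotone fun s => T n (restr X s))
    (hnull : ∀ n, μ (D \ {X | ∃ s, T n (restr X s) = true}) = 0) :
    ∃ u : ℕ → ℕ, Computable u ∧ μ (D ∩ {X | ∀ n, T n (restr X (u n)) = true}) ≠ 0 := by
  obtain ⟨t, ht, hanti, rfl⟩ := hD.exists_tree
  obtain ⟨K, hK⟩ := exists_inv_two_pow_lt hpos
  let P : ℕ → List Bool → Bool := fun n σ => t σ && !T n σ
  have hP : Computable₂ P :=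
    Primrec.and.to_comp.comp (ht.comp Computable.snd) (Primrec.not.to_comp.comp hT)
  have hP_anti : ∀ n X, Antitone fun s => P n (restr X s) := fun n X s s' hs =>
    inf_le_inf (hanti X hs) (compl_le_compl (hmono n X hs))
  have hP_null : ∀ n, μ {X | ∀ s, P n (restr X s) = true} = 0 := fun n => by
    simpa [P, forall_and, sdiff_eq_compl_inter, inter_def, compl_def, and_comm] using hnull n
  obtain ⟨u, hu, huμ⟩ := hμ.exists_stage hP hP_anti hP_null
    (k := fun n => K + (n + 1)) (Primrec.nat_add.to_comp.comp (Computable.const K) Computable.succ)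
  refine ⟨u, hu, fun hzero => hK.not_ge ?_⟩
  calc μ {X | ∀ s, t (restr X s) = true}
      ≤ μ ({X | ∀ s, t (restr X s) = true} ∩ {X | ∀ n, T n (restr X (u n)) = true}) +
          μ (⋃ n, {X | P n (restr X (u n)) = true}) := by
        refine (measure_mono fun X hX => ?_).trans (measure_union_le _ _)
        by_cases h : ∀ n, T n (restr X (u n)) = true
        · exact Or.inl ⟨hX, h⟩
        · obtain ⟨n, hn⟩ := not_forall.1 h
          exact Or.inr (mem_iUnion.2 ⟨n, by simp [P, hX (u n), hn]⟩)
    _ ≤ ∑' n : ℕ, (2 : ℝ≥0∞)⁻¹ ^ (K + (n + 1)) := by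
        rw [hzero, zero_add]
        exact (measure_iUnion_le _).trans (ENNReal.tsum_le_tsum fun n => (huμ n).le)
    _ = (2 : ℝ≥0∞)⁻¹ ^ K := by
        simp_rw [pow_add (2 : ℝ≥0∞)⁻¹ K]
        rw [ENNReal.tsum_mul_left, ENNReal.tsum_geometric_add_one, ENNReal.one_sub_inv_two, inv_inv,
          ENNReal.inv_mul_cancel (by simp) (by simp), mul_one]

namespace TuringFunctional

variable (Φ : TuringFunctional) {X Y : Cantor}

/-- The sequences `X` for which the computation of the bit `Φ(X)(n)` converges; `dom Φ` is the
intersection of these open classes. -/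
def convergesAt (n : ℕ) : Set Cantor := {X | ∃ τ ∈ Φ.outputs X, n < τ.length}

theorem dom_subset_convergesAt (n : ℕ) : Φ.dom ⊆ Φ.convergesAt n := fun _ hX => hX (n + 1)

theorem mem_convergesAt_iff {n : ℕ} :
    X ∈ Φ.convergesAt n ↔ ∃ b, ∃ τ ∈ Φ.outputs X, τ[n]? = some b := by
  simp only [convergesAt, mem_ofPred_eq, List.getElem?_eq_some_iff]
  exact ⟨fun ⟨τ, hτ, h⟩ => ⟨_, τ, hτ, h, rfl⟩, fun ⟨_, τ, hτ, h, _⟩ => ⟨τ, hτ, h⟩⟩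

theorem isPi01_compl_convergesAt (n : ℕ) : IsPi01 (Φ.convergesAt n)ᶜ := by
  refine ⟨{σ | ∃ τ, (σ, τ) ∈ Φ.graph ∧ n < τ.length}, re_exists (re_and Φ.re ?_), ?_⟩
  · exact ((Primrec.nat_lt.comp (Primrec.const n)
      (Primrec.list_length.comp Primrec.snd)).computablePred).to_re
  · ext X
    rw [compl_compl, mem_biUnion_cylinder_iff]
    exact ⟨fun ⟨τ, ⟨m, hm⟩, h⟩ => ⟨m, τ, hm, h⟩, fun ⟨m, τ, hm, h⟩ => ⟨τ, ⟨m, hm⟩, h⟩⟩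

theorem exists_stages : ∃ B : ℕ × Bool → List Bool → Bool, Computable₂ B ∧
    (∀ q X, Monotone fun s => B q (restr X s)) ∧
    ∀ n b X, (∃ s, B (n, b) (restr X s) = true) ↔ ∃ τ ∈ Φ.outputs X, τ[n]? = some b := by
  have hgraph : REPred fun q : ((ℕ × Bool) × List Bool) × List Bool => (q.1.2, q.2) ∈ Φ.graph :=
    re_comp Φ.re ((Computable.snd.comp Computable.fst).pair Computable.snd)
  have hbit : REPred fun q : ((ℕ × Bool) × List Bool) × List Bool =>
      q.2[q.1.1.1]? = some q.1.1.2 :=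
    ((Primrec.eq.comp (Primrec.list_getElem?.comp Primrec.snd
      (Primrec.fst.comp (Primrec.fst.comp Primrec.fst))) (Primrec.option_some.comp
        (Primrec.snd.comp (Primrec.fst.comp Primrec.fst)))).computablePred).to_re
  obtain ⟨B, hB, hmono, hBp⟩ := exists_stages_of_re
    (p := fun q σ => ∃ τ, (σ, τ) ∈ Φ.graph ∧ τ[q.1]? = some q.2) (re_exists (re_and hgraph hbit))
  refine ⟨B, hB, hmono, fun n b X => (hBp (n, b) X).trans ?_⟩
  exact ⟨fun ⟨m, τ, hm, h⟩ => ⟨τ, ⟨m, hm⟩, h⟩, fun ⟨τ, ⟨m, hm⟩, h⟩ => ⟨m, τ, hm, h⟩⟩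

variable {Φ}

theorem maps_of_forall_getElem? (h : ∀ n, ∃ τ ∈ Φ.outputs X, τ[n]? = some (Y n)) : Φ.Maps X Y := by
  refine ⟨fun n => ?_, funext fun n => ?_⟩
  · obtain ⟨τ, hτ, hn⟩ := h n
    exact ⟨τ, hτ, (List.getElem?_eq_some_iff.1 hn).1.le⟩
  · obtain ⟨τ, hτ, hn⟩ := h n
    exact (mem_cylinder_iff _ _).1 (Φ.eval_mem_cylinder hτ) n _ hn

theorem exists_ttFunctional_maps (hμ : IsComputableMeasure μ) (hD : IsPi01 D) (hpos : μ D ≠ 0)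
    (hconv : ∀ n, μ (D \ Φ.convergesAt n) = 0) :
    ∃ E ⊆ D, IsPi01 E ∧ μ E ≠ 0 ∧ ∃ F, IsTTFunctional F ∧ ∀ X ∈ E, Φ.Maps X (F X) := by
  obtain ⟨B, hB, hmono, hBΦ⟩ := Φ.exists_stages
  let T : ℕ → List Bool → Bool := fun n σ => B (n, true) σ || B (n, false) σ
  have hB_bit : ∀ b, Computable₂ fun n σ => B (n, b) σ := fun b =>
    (hB.comp (Computable.fst.pair (Computable.const b)) Computable.snd).to₂
  have hT : Computable₂ T := Primrec.or.to_comp.comp (hB_bit true) (hB_bit false)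
  have hT_iff : ∀ n, {X | ∃ s, T n (restr X s) = true} = Φ.convergesAt n := fun n =>
    Set.ext fun X => by simp [T, mem_convergesAt_iff, ← hBΦ, exists_or, or_comm]
  obtain ⟨u, hu, huμ⟩ := hμ.exists_uniform_stage hD hpos hT
    (fun n X s s' hs => sup_le_sup (hmono (n, true) X hs) (hmono (n, false) X hs))
    (fun n => by rw [hT_iff]; exact hconv n)
  refine ⟨_, inter_subset_left, hD.inter (isPi01_setOf_forall_restr hT hu), huμ,
    fun X n => B (n, true) (restr X (u n)), ⟨u, _, hu, hB_bit true, fun _ _ => rfl⟩, ?_⟩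
  rintro X ⟨-, hX⟩
  refine maps_of_forall_getElem? fun n => (hBΦ n _ X).1 ⟨u n, ?_⟩
  have hn : (B (n, true) (restr X (u n)) || B (n, false) (restr X (u n))) = true := hX n
  cases htrue : B (n, true) (restr X (u n)) with
  | true => simp [htrue]
  | false => simpa [htrue] using hn

theorem exists_avoiding_subclass (hμ : IsComputableMeasure μ) (hC : IsPi01 C)
    (hneg : TTNegligible C) (hD : IsPi01 D) (hpos : μ D ≠ 0) (Φ : TuringFunctional) :
    ∃ E ⊆ D, IsPi01 E ∧ μ E ≠ 0 ∧ ∀ X ∈ E, X ∈ Φ.dom → Φ.eval X ∉ C := by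
  by_cases hconv : ∀ n, μ (D \ Φ.convergesAt n) = 0
  · obtain ⟨E, hED, hE, hEpos, F, hF, hEF⟩ := exists_ttFunctional_maps hμ hD hpos hconv
    obtain ⟨σ, hσC, hσ⟩ : ∃ σ, Disjoint (cylinder σ) C ∧ μ (E ∩ F ⁻¹' cylinder σ) ≠ 0 := by
      by_contra! hnull
      refine hEpos (measure_mono_null (fun X hX => ?_) (measure_union_null (hneg.preimage hF μ hμ)
        ((measure_biUnion_null_iff (to_countable {σ | Disjoint (cylinder σ) C})).2 hnull)))
      by_cases hFX : F X ∈ C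
      · exact Or.inl hFX
      · obtain ⟨σ, hXσ, hσC⟩ := hC.exists_cylinder_disjoint hFX
        exact Or.inr (mem_biUnion hσC ⟨hX, hXσ⟩)
    refine ⟨E ∩ F ⁻¹' cylinder σ, inter_subset_left.trans hED,
      hE.inter (hF.isPi01_preimage_cylinder σ), hσ, fun X hX _ => ?_⟩
    rw [(hEF X hX.1).2]
    exact disjoint_left.1 hσC hX.2
  · obtain ⟨n, hn⟩ := not_forall.1 hconv
    exact ⟨D \ Φ.convergesAt n, sdiff_subset, hD.inter (Φ.isPi01_compl_convergesAt n), hn,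
      fun X hX hdom _ => hX.2 (Φ.dom_subset_convergesAt n hdom)⟩

instance : Countable TuringFunctional := by
  have := (countable_setOf_rePred (α := List Bool × List Bool)).to_subtype
  refine Function.Injective.countable
    (f := fun Φ => (⟨Φ.graph, Φ.re⟩ : {S : Set _ | REPred fun p => p ∈ S})) ?_
  rintro ⟨_, _, _⟩ ⟨_, _, _⟩ h
  cases Subtype.ext_iff.1 h
  rfl

end TuringFunctional

/- A forcing argument: the sets with `p` are the conditions, and every `Q i` is a dense
requirement. -/
theorem exists_mem_forall_of_forall_exists_subset {X ι : Type*} [TopologicalSpace X]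
    [CompactSpace X] [Countable ι] {p : Set X → Prop} {Q : ι → X → Prop}
    (hp : ∀ E, p E → IsClosed E ∧ E.Nonempty)
    (hdense : ∀ i E, p E → ∃ E' ⊆ E, p E' ∧ ∀ x ∈ E', Q i x) {D : Set X} (hD : p D) :
    ∃ x ∈ D, ∀ i, Q i x := by
  cases isEmpty_or_nonempty ι with
  | inl => exact (hp D hD).2.imp fun x hx => ⟨hx, isEmptyElim⟩
  | inr =>
    obtain ⟨e, he⟩ := exists_surjective_nat ι
    have extend : ∀ (n : ℕ) (E : {E // p E}), ∃ E' : {E // p E}, E'.1 ⊆ E.1 ∧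
        ∀ x ∈ E'.1, Q (e n) x := fun n ⟨E, hE⟩ => by
      obtain ⟨E', hsub, hE', hQ⟩ := hdense (e n) E hE
      exact ⟨⟨E', hE'⟩, hsub, hQ⟩
    choose next hnext_sub hnext using extend
    let E : ℕ → {E // p E} := fun n => Nat.rec ⟨D, hD⟩ next n
    obtain ⟨x, hx⟩ := IsCompact.nonempty_iInter_of_sequence_nonempty_isCompact_isClosed
      (fun n => (E n).1) (fun n => hnext_sub n (E n)) (fun n => (hp _ (E n).2).2)
      (hp D hD).1.isCompact fun n => (hp _ (E n).2).1
    rw [mem_iInter] at hx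
    refine ⟨x, hx 0, he.forall.2 fun n => hnext n (E n) x (hx (n + 1))⟩

theorem MuchnikLE.ttNegligible {C D : Pi01Class} (h : MuchnikLE C D)
    (hC : TTNegligible C.carrier) : TTNegligible D.carrier := by
  intro μ hμ
  by_contra hpos
  obtain ⟨X, hX, havoid⟩ := exists_mem_forall_of_forall_exists_subset
    (p := fun E => IsPi01 E ∧ μ E ≠ 0)
    (Q := fun (Φ : TuringFunctional) X => X ∈ Φ.dom → Φ.eval X ∉ C.carrier)
    (fun E hE => ⟨hE.1.isClosed, nonempty_of_measure_ne_zero hE.2⟩)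
    (fun Φ E hE => by
      simpa only [and_assoc] using
        TuringFunctional.exists_avoiding_subclass hμ C.isPi01 hC hE.1 hE.2 Φ)
    ⟨D.isPi01, hpos⟩
  obtain ⟨Φ, hdom, hmem⟩ := h X hX
  exact havoid Φ hdom hmem

end Forcing

section Degrees

theorem MedvedevLE.muchnikLE {C D : Pi01Class} (h : MedvedevLE C D) : MuchnikLE C D := by
  obtain ⟨Φ, hdom, hmaps⟩ := h
  exact fun X hX => ⟨Φ, hdom hX, hmaps (mem_image_of_mem _ hX)⟩

theorem exists_ttDeep : ∃ C : Pi01Class, TTDeep C.carrier :=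
  ⟨⟨∅, isPi01_empty⟩, isPi01_empty.ttDeep fun _ _ => measure_empty⟩

variable {L : Type*} {deg : Pi01Class → L}

theorem ttDeep_congr [Preorder L] (hle : ∀ C D, deg C ≤ deg D → MuchnikLE C D) {C D : Pi01Class}
    (h : deg C = deg D) : TTDeep C.carrier ↔ TTDeep D.carrier := by
  rw [C.isPi01.ttDeep_iff, D.isPi01.ttDeep_iff]
  exact ⟨(hle C D h.le).ttNegligible, (hle D C h.ge).ttNegligible⟩

theorem isLatticeFilter_degrees [Lattice L] (hsurj : Function.Surjective deg)
    (hle : ∀ C D, deg C ≤ deg D → MuchnikLE C D)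
    (hinf : ∀ C D, deg C ⊓ deg D = deg (C.inf D)) :
    IsLatticeFilter {d | ∃ C : Pi01Class, TTDeep C.carrier ∧ deg C = d} := by
  refine ⟨?_, ?_, ?_⟩
  · obtain ⟨C, hC⟩ := exists_ttDeep
    exact ⟨_, C, hC, rfl⟩
  · rintro _ y ⟨C, hC, rfl⟩ h
    obtain ⟨D, rfl⟩ := hsurj y
    exact ⟨D, D.isPi01.ttDeep ((hle C D h).ttNegligible hC.ttNegligible), rfl⟩
  · rintro _ _ ⟨C, hC, rfl⟩ ⟨D, hD, rfl⟩
    exact ⟨C.inf D, (C.inf D).isPi01.ttDeep (hC.ttNegligible.infSet hD.ttNegligible),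
      (hinf C D).symm⟩

end Degrees

end MassProblems

theorem mainTheorem5 :
    -- for `Π⁰₁` classes, tt-depth and tt-negligibility coincide
    (∀ C : MassProblems.Pi01Class,
      MassProblems.TTDeep C.carrier ↔ MassProblems.TTNegligible C.carrier) ∧
    -- tt-depth is an invariant of the Medvedev degree
    (∀ C D : MassProblems.Pi01Class, MassProblems.medvedevDeg C = MassProblems.medvedevDeg D →
      (MassProblems.TTDeep C.carrier ↔ MassProblems.TTDeep D.carrier)) ∧
    -- the Medvedev degrees of tt-deep classes form a filter
    MassProblems.IsLatticeFilter
      {d : MassProblems.MedvedevDegree | ∃ C : MassProblems.Pi01Class,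
        MassProblems.TTDeep C.carrier ∧ MassProblems.medvedevDeg C = d} ∧
    -- tt-depth is an invariant of the Muchnik degree
    (∀ C D : MassProblems.Pi01Class, MassProblems.muchnikDeg C = MassProblems.muchnikDeg D →
      (MassProblems.TTDeep C.carrier ↔ MassProblems.TTDeep D.carrier)) ∧
    -- the Muchnik degrees of tt-deep classes form a filter
    MassProblems.IsLatticeFilter
      {d : MassProblems.MuchnikDegree | ∃ C : MassProblems.Pi01Class,
        MassProblems.TTDeep C.carrier ∧ MassProblems.muchnikDeg C = d} := by
  open MassProblems in
  exact ⟨fun C => C.isPi01.ttDeep_iff,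
    fun _ _ => ttDeep_congr fun _ _ => MedvedevLE.muchnikLE,
    isLatticeFilter_degrees Quotient.exists_rep (fun _ _ => MedvedevLE.muchnikLE) medvedevDeg_inf,
    fun _ _ => ttDeep_congr fun C D => (muchnikDeg_le C D).1,
    isLatticeFilter_degrees Quotient.exists_rep (fun C D => (muchnikDeg_le C D).1) muchnikDeg_inf⟩
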